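/- Let $M$ be a smooth manifold (Hausdorff, second countable, without boundary) with a complex divisor $(U,s)$, i.e. a smooth complex line bundle $U\to M$ with a smooth section $s$ transverse to the zero section, and let $D=\{s=0\}$. Let $(R,q)$ be the induced elliptic divisor: $R$ is the real part of $U\otimes\bar U$ and $q=s\otimes\bar s$, and $I_q\subset C^\infty(M)$ is its ideal, the image of $q:\Gamma(R^*)\to C^\infty(M)$. Let $TM(-\log|D|)$ be the elliptic tangent bundle, i.e. the vector bundle whose sections are the vector fields $X$ on $M$ with $X(I_q)\subset I_q$, with its anchor $a:TM(-\log|D|)\to TM$, and let $\Omega^j(M,\log|D|)=\Gamma(\wedge^jTM(-\log|D|)^*)$. Let $\iota:Y\hookrightarrow M$ be an embedded submanifold with smooth boundary, $\dim Y\ge 1$, such that $\partial Y=Y\cap D$ and $T(Y\cap D)=TY\cap TD$ at all points of $Y\cap D$. Let $TY(-\log\partial Y)$ be the real logarithmic tangent bundle, whose sections are the vector fields on $Y$ preserving the ideal of functions vanishing on $\partial Y$, with its anchor $a_Y$ to $TY$, and let $\Omega^j(Y,\log\partial Y)=\Gamma(\wedge^jTY(-\log\partial Y)^*)$. Then there is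 a morphism of smooth vector bundles over $Y$ $$\iota_*:TY(-\log\partial Y)\to TM(-\log|D|)|_Y,\qquad a\circ\iota_*=d\iota\circ a_Y,$$ and it is the only morphism of smooth vector bundles that agrees with the ordinary pushforward over $Y\setminus\partial Y$ (that is, satisfies the displayed relation there). For every $j\ge 0$, dualising $\iota_*$ gives a linear map $$\iota^*:\Omega^j(M,\log|D|)\to\Omega^j(Y,\log\partial Y),\qquad (\iota^*\alpha)_y(v_1,\dots,v_j)=\alpha_{\iota(y)}(\iota_*v_1,\dots,\iota_*v_j).$$ For each $\alpha$, the form $\iota^*\alpha$ is the ordinary pullback of $\alpha$ over $Y\setminus\partial Y$, and it is the unique smooth logarithmic form on $Y$ with this property. In particular the condition $\iota^*\omega=0$ makes sense for every elliptic two-form $\omega$ on $M$. -/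

import Mathlib

open scoped Manifold ContDiff Topology ComplexConjugate
open Bundle

noncomputable section

namespace EllipticGeometry

section VectorFields

variable {E : Type*} [NormedAddCommGroup E] [NormedSpace ℝ E] {H : Type*} [TopologicalSpace H]
  (I : ModelWithCorners ℝ E H) (M : Type*) [TopologicalSpace M] [ChartedSpace H M]

/-- Smooth real functions on a manifold (possibly with boundary). -/
abbrev SmoothFun := C^∞⟮I, M; ℝ⟯

variable [IsManifold I ∞ M]

/-- Smooth vector fields on a manifold (possibly with boundary). -/
abbrev VField := Cₛ^∞⟮I; E, (TangentSpace I : M → Type _)⟯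

instance : SMul (SmoothFun I M) (VField I M) :=
  ⟨fun f X => ⟨fun p => f p • X p, f.contMDiff.smul_section X.contMDiff⟩⟩

variable {I M}

theorem smul_apply (f : SmoothFun I M) (X : VField I M) (p : M) : (f • X) p = f p • X p := rfl

instance : Module (SmoothFun I M) (VField I M) where
  one_smul X := by ext p; exact one_smul ℝ (X p)
  mul_smul f g X := by ext p; exact mul_smul (f p) (g p) (X p)
  smul_zero f := by ext p; exact smul_zero (f p)
  smul_add f X Y := by ext p; exact smul_add (f p) (X p) (Y p)
  add_smul f g X := by ext p; exact add_smul (f p) (g p) (X p)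
  zero_smul X := by ext p; exact zero_smul ℝ (X p)

instance : IsScalarTower ℝ (SmoothFun I M) (VField I M) where
  smul_assoc c f X := by ext p; exact smul_assoc c (f p) (X p)

/-- The ideal of smooth functions vanishing on a set `Z`. -/
def vanishingIdeal (Z : Set M) : Ideal (SmoothFun I M) where
  carrier := {f | ∀ p ∈ Z, f p = 0}
  add_mem' := fun {f g} hf hg p hp => by
    change f p + g p = 0
    rw [hf p hp, hg p hp, add_zero]
  zero_mem' := fun _ _ => rfl
  smul_mem' := fun c f hf p hp => by
    change c p * f p = 0
    rw [hf p hp, mul_zero]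

/-- The module of vector fields `X` with `X(J) ⊆ J`, for an ideal `J` of smooth functions;
here `X(f)` is the function `p ↦ df_p(X_p)`. -/
def preservingFields (J : Ideal (SmoothFun I M)) : Submodule (SmoothFun I M) (VField I M) where
  carrier := {X | ∀ f ∈ J, ∃ g ∈ J, ∀ p, g p = mfderiv I 𝓘(ℝ, ℝ) f p (X p)}
  add_mem' := fun {X Y} hX hY f hf => by
    obtain ⟨g, hg, hgX⟩ := hX f hf
    obtain ⟨g', hg', hgY⟩ := hY f hf
    refine ⟨g + g', J.add_mem hg hg', fun p => ?_⟩
    change g p + g' p = mfderiv I 𝓘(ℝ, ℝ) f p (X p + Y p)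
    rw [map_add, hgX, hgY]
    rfl
  zero_mem' := fun f _ => ⟨0, J.zero_mem, fun p => by
    change (0 : ℝ) = mfderiv I 𝓘(ℝ, ℝ) f p 0
    rw [map_zero]
    rfl⟩
  smul_mem' := fun c X hX f hf => by
    obtain ⟨g, hg, hgX⟩ := hX f hf
    refine ⟨c * g, J.mul_mem_left c hg, fun p => ?_⟩
    change c p * g p = mfderiv I 𝓘(ℝ, ℝ) f p (c p • X p)
    rw [map_smul, hgX]
    rfl

/-! ### The vector bundle determined by a module of vector fields -/

variable (𝓔 : Submodule (SmoothFun I M) (VField I M))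

/-- `𝔪_p 𝓔`, where `𝔪_p` is the ideal of functions vanishing at `p`. -/
def fibreKernel (p : M) : Submodule ℝ 𝓔 :=
  ((vanishingIdeal {p} : Ideal (SmoothFun I M)) • (⊤ : Submodule (SmoothFun I M) 𝓔)).restrictScalars ℝ

/-- The fibre at `p` of the vector bundle whose module of smooth sections is `𝓔`,
namely `𝓔 / 𝔪_p 𝓔`. -/
abbrev Fibre (p : M) : Type _ := 𝓔 ⧸ fibreKernel 𝓔 p

/-- The value at `p`, in the fibre, of a section `X ∈ 𝓔`. -/
def fibreEval (p : M) : 𝓔 →ₗ[ℝ] Fibre 𝓔 p := (fibreKernel 𝓔 p).mkQ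

/-- The value at `p`, as a tangent vector, of a vector field. -/
def tangentEval (p : M) : 𝓔 →ₗ[ℝ] TangentSpace I p where
  toFun X := (X : VField I M) p
  map_add' _ _ := rfl
  map_smul' _ _ := rfl

theorem fibreKernel_le_ker (p : M) : fibreKernel 𝓔 p ≤ LinearMap.ker (tangentEval 𝓔 p) := by
  have key : ∀ X ∈ (vanishingIdeal {p} : Ideal (SmoothFun I M)) •
      (⊤ : Submodule (SmoothFun I M) 𝓔), (X : VField I M) p = 0 := by
    intro X hX
    induction hX using Submodule.smul_induction_on' with
    | smul f hf Y _ =>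
      rw [Submodule.coe_smul, smul_apply, hf p rfl, zero_smul]
    | add Y _ Z _ hY hZ =>
      rw [Submodule.coe_add]
      exact (congrArg₂ (· + ·) hY hZ).trans (add_zero 0)
  exact fun X hX => key X hX

/-- The anchor, sending the class of a vector field `X` at `p` to the tangent vector `X_p`. -/
def anchor (p : M) : Fibre 𝓔 p →ₗ[ℝ] TangentSpace I p :=
  (fibreKernel 𝓔 p).liftQ (tangentEval 𝓔 p) (fibreKernel_le_ker 𝓔 p)

/-- Smooth sections of the `q`-th exterior power of the dual of the bundle with sections `𝓔`:
families of alternating `q`-forms on the fibres whose values on sections are smooth functions. -/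
def Form (q : ℕ) : Submodule ℝ ((p : M) → (Fibre 𝓔 p) [⋀^Fin q]→ₗ[ℝ] ℝ) where
  carrier := {α | ∀ X : Fin q → 𝓔,
    ContMDiff I 𝓘(ℝ, ℝ) ∞ fun p => α p fun i => fibreEval 𝓔 p (X i)}
  add_mem' := fun hα hβ X => (hα X).add (hβ X)
  zero_mem' := fun _ => contMDiff_const
  smul_mem' := fun _ _ hα X => contMDiff_const.mul (hα X)

variable {E' : Type*} [NormedAddCommGroup E'] [NormedSpace ℝ E'] {H' : Type*} [TopologicalSpace H']
  (I' : ModelWithCorners ℝ E' H') {Y : Type*} [TopologicalSpace Y] [ChartedSpace H' Y]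

/-- Smoothness of a section along `ι : Y → M` (that is, of the pullback to `Y` of the bundle with
sections `𝓔`): locally it is a combination, with smooth functions on `Y` as coefficients, of
restrictions to `Y` of sections in `𝓔`. -/
def IsSmoothSectionAlong (ι : Y → M)
    (σ : (y : Y) → Fibre 𝓔 (ι y)) : Prop :=
  ∀ y₀ : Y, ∃ (r : ℕ) (f : Fin r → SmoothFun I' Y) (X : Fin r → 𝓔),
    ∀ᶠ y in 𝓝 y₀, σ y = ∑ j, f j y • fibreEval 𝓔 (ι y) (X j)

variable {I'} in
/-- A fibrewise linear map, over `Y`, from the bundle with sections `𝓕` to the pullback along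
`ι : Y → M` of the bundle with sections `𝓔` is a morphism of smooth vector bundles when it sends
smooth sections to smooth sections. -/
def IsSmoothBundleMap [IsManifold I' ∞ Y] (ι : Y → M)
    (𝓕 : Submodule (SmoothFun I' Y) (VField I' Y))
    (Φ : (y : Y) → Fibre 𝓕 y →ₗ[ℝ] Fibre 𝓔 (ι y)) : Prop :=
  ∀ V : 𝓕, IsSmoothSectionAlong 𝓔 I' ι fun y => Φ y (fibreEval 𝓕 y V)

/-- Sections of the real logarithmic tangent bundle for a hypersurface `Z` (here, the boundary):
the vector fields preserving the vanishing ideal of `Z`. -/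
def logFields (Z : Set M) : Submodule (SmoothFun I M) (VField I M) :=
  preservingFields (vanishingIdeal Z)

end VectorFields

section Divisors

variable {E : Type*} [NormedAddCommGroup E] [NormedSpace ℝ E] {H : Type*} [TopologicalSpace H]
  (I : ModelWithCorners ℝ E H) {M : Type*} [TopologicalSpace M] [ChartedSpace H M]
  (U : M → Type*) [TopologicalSpace (TotalSpace ℂ U)] [∀ p, AddCommGroup (U p)]
  [∀ p, Module ℂ (U p)] [∀ p, TopologicalSpace (U p)] [FiberBundle ℂ U] [VectorBundle ℝ ℂ U]

/-- A complex divisor: a smooth section of the complex line bundle `U` that is transverse to the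
zero section, i.e. whose derivative at each zero, in a local trivialisation, is onto `ℂ`. -/
structure ComplexDivisor where
  sec : Cₛ^∞⟮I; ℂ, U⟯
  transverse : ∀ p, sec p = 0 → Function.Surjective
    (mfderiv I 𝓘(ℝ, ℂ) (fun x => (trivializationAt ℂ U p ⟨x, sec x⟩).2) p)

/-- Smooth fields of Hermitian forms on the fibres of `U`, i.e. smooth sections of the dual `R^*` of
the real line bundle `R` of real elements of `U ⊗ Ū`. -/
structure HermitianField where
  form : (p : M) → U p →ₗ⋆[ℂ] U p →ₗ[ℂ] ℂ
  hermitian : ∀ p u v, conj (form p u v) = form p v u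
  smooth : ∀ u : Cₛ^∞⟮I; ℂ, U⟯, ContMDiff I 𝓘(ℝ, ℂ) ∞ fun p => form p (u p) (u p)

variable {I U}

namespace ComplexDivisor

variable (D : ComplexDivisor I U)

/-- The zero locus of the divisor. -/
def locus : Set M := {p | D.sec p = 0}

/-- The tangent space at `p ∈ D` of the zero locus: the kernel of the derivative of the section in
a local trivialisation. -/
def tangent (p : M) : Submodule ℝ (TangentSpace I p) :=
  LinearMap.ker (mfderiv I 𝓘(ℝ, ℂ)
    (fun x => (trivializationAt ℂ U p ⟨x, D.sec x⟩).2) p).toLinearMap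

/-- The ideal of the induced elliptic divisor `(R, q)`, where `R` is the real part of `U ⊗ Ū` and
`q = s ⊗ s̄`: the image of the pairing of `q` with the sections of `R^*`, sending a field of
Hermitian forms `h` to the function `h(s, s)`. -/
def ellipticIdeal : Ideal (SmoothFun I M) where
  carrier := {f | ∃ h : HermitianField I U, ∀ p, (f p : ℂ) = h.form p (D.sec p) (D.sec p)}
  add_mem' := by
    rintro f g ⟨h, hh⟩ ⟨k, hk⟩
    refine ⟨⟨fun p => h.form p + k.form p, fun p u v => ?_, fun u => ?_⟩, fun p => ?_⟩
    · simp [h.hermitian, k.hermitian]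
    · exact (h.smooth u).add (k.smooth u)
    · change ((f p + g p : ℝ) : ℂ) = _
      rw [Complex.ofReal_add, hh, hk]
      rfl
  zero_mem' := ⟨⟨fun _ => 0, fun p u v => by simp, fun u => contMDiff_const⟩, fun p => by
    change ((0 : ℝ) : ℂ) = 0
    simp⟩
  smul_mem' := by
    rintro c f ⟨h, hh⟩
    refine ⟨⟨fun p => (c p : ℂ) • h.form p, fun p u v => ?_, fun u => ?_⟩, fun p => ?_⟩
    · simp [h.hermitian]
    · have hc : ContMDiff I 𝓘(ℝ, ℂ) ∞ fun p => c p • h.form p (u p) (u p) :=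
        c.contMDiff.smul (h.smooth u)
      exact hc.congr fun p => (Complex.real_smul).symm
    · change ((c p * f p : ℝ) : ℂ) = _
      rw [Complex.ofReal_mul, hh]
      rfl

/-- Sections of the elliptic tangent bundle: vector fields preserving the elliptic ideal. -/
def ellipticFields [IsManifold I ∞ M] : Submodule (SmoothFun I M) (VField I M) :=
  preservingFields D.ellipticIdeal

end ComplexDivisor

end Divisors

section Boundary

variable {k : ℕ} [NeZero k] {Y : Type*} [TopologicalSpace Y] [ChartedSpace (EuclideanHalfSpace k) Y]

/-- The tangent space of `∂Y` at a boundary point `y`: the kernel of the differential of the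
coordinate defining the boundary, in the chart at `y`. -/
def boundaryTangent (y : Y) : Submodule ℝ (TangentSpace (𝓡∂ k) y) :=
  LinearMap.ker (mfderiv (𝓡∂ k) 𝓘(ℝ, ℝ)
    (fun x => (extChartAt (𝓡∂ k) y x : EuclideanSpace ℝ (Fin k)) 0) y).toLinearMap

end Boundary

end EllipticGeometry

end

noncomputable section

namespace EllipticGeometry

/-! ### Integrals depending smoothly on a parameter, and Hadamard's lemma -/

section Calculus

universe u
variable {E F : Type u} [NormedAddCommGroup E] [NormedSpace ℝ E]
  [NormedAddCommGroup F] [NormedSpace ℝ F]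

/-! In a trivialisation the divisor is a complex function σ, and the elliptic ideal is locally
generated by |σ|². Up to cutoffs, a field X preserves this ideal exactly when X(σ) = cσ near each
point with c smooth and complex. Sufficiency is a computation (`mem_ellipticFields_of_eq_mul`).
Conversely, X|σ|² = 2 Re(σ̄ X(σ)) = h|σ|² says that ζ = X(σ) - (h/2)σ satisfies Re(σ̄ζ) = 0. By
transversality σ is linear in suitable coordinates near a zero, and Hadamard's lemma then gives ζ =
ibσ with b smooth and real (`exists_contDiffOn_eq_I_mul`).

Consequently there are local elliptic frames in which a tangent vector w with dσ(w) = cσ has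
coefficients linear in c and in the chart expression of w (`exists_frame`). A field along a map into
M is thus a smooth combination of elliptic fields as soon as its quotient c and its chart expression
are smooth.

On Y the function σ∘ι vanishes along ∂Y. Its differential is nonzero there: otherwise dι(TY) would
lie in TD, and the clean intersection condition together with injectivity of dι would give T∂Y = TY.
Hence σ∘ι = tτ with t a boundary coordinate and τ ≠ 0. A logarithmic field V has V(t) = tw, so
V(σ∘ι) = (w + V(τ)/τ) σ∘ι, which is the required quotient (`exists_pushforward_eq_sum`).

Over D the anchor need not be injective, so a combination of elliptic fields has to be shown to
determine an element of the fibre. Off D the frame is linearly independent, and Y∖∂Y is dense, so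
the frame coefficients are determined by continuity (`sum_smul_fibreEval_eq_zero`). This one
principle makes the pushforward well defined, linear and unique. The claims on forms follow by
multilinearity and density. -/

theorem hasFDerivWithinAt_integral_of_continuousOn [CompleteSpace F] {S : Set E} (hS : Convex ℝ S)
    {G : E × ℝ → F} {G' : E × ℝ → E →L[ℝ] F}
    (hG : ContinuousOn G (S ×ˢ Set.Icc (0 : ℝ) 1)) (hG' : ContinuousOn G' (S ×ˢ Set.Icc (0 : ℝ) 1))
    (h : ∀ x ∈ S, ∀ s ∈ Set.Icc (0 : ℝ) 1,
      HasFDerivWithinAt (fun z => G (z, s)) (G' (x, s)) S x)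
    {x : E} (hx : x ∈ S) :
    HasFDerivWithinAt (fun z => ∫ s in (0 : ℝ)..1, G (z, s))
      (∫ s in (0 : ℝ)..1, G' (x, s)) S x := by
  have slice : ∀ z ∈ S, Set.MapsTo (fun s : ℝ => (z, s)) (Set.Icc 0 1) (S ×ˢ Set.Icc (0 : ℝ) 1) :=
    fun z hz s hs => ⟨hz, hs⟩
  have hint : ∀ z ∈ S, IntervalIntegrable (fun s => G (z, s)) MeasureTheory.volume 0 1 := by
    intro z hz
    apply ContinuousOn.intervalIntegrable
    rw [Set.uIcc_of_le zero_le_one]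
    exact hG.comp (by fun_prop) (slice z hz)
  have hint' : IntervalIntegrable (fun s => G' (x, s)) MeasureTheory.volume 0 1 := by
    apply ContinuousOn.intervalIntegrable
    rw [Set.uIcc_of_le zero_le_one]
    exact hG'.comp (by fun_prop) (slice x hx)
  have hint'' : ∀ w, IntervalIntegrable (fun s => G' (x, s) w) MeasureTheory.volume 0 1 := by
    intro w
    apply ContinuousOn.intervalIntegrable
    rw [Set.uIcc_of_le zero_le_one]
    exact (hG'.comp (f := fun s : ℝ => (x, s)) (by fun_prop) (slice x hx)).clm_apply continuousOn_const
  rw [hasFDerivWithinAt_iff_isLittleO, Asymptotics.isLittleO_iff]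
  intro ε hε
  -- Compactness of [0, 1] makes `G' (z, s)` close to `G' (x, s)` uniformly in s. The mean value
  -- inequality on a convex neighbourhood then bounds the remainder for all s at once.
  obtain ⟨v, hv, hvε⟩ := isCompact_Icc.mem_uniformity_of_prod (s := S) (k := Set.Icc (0 : ℝ) 1)
    (f := fun x s => G' (x, s)) hG' hx (Metric.dist_mem_uniformity hε)
  obtain ⟨r, hr, hrv⟩ := Metric.mem_nhdsWithin_iff.1 hv
  filter_upwards [inter_mem_nhdsWithin S (Metric.ball_mem_nhds x hr)] with z hz
  have hconv : Convex ℝ (S ∩ Metric.ball x r) := hS.inter (convex_ball x r)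
  have bound : ∀ s ∈ Set.Icc (0 : ℝ) 1,
      ‖G (z, s) - G (x, s) - G' (x, s) (z - x)‖ ≤ ε * ‖z - x‖ := by
    intro s hs
    refine hconv.norm_image_sub_le_of_norm_hasFDerivWithin_le' (f := fun z => G (z, s))
      (f' := fun z => G' (z, s)) (fun y hy => (h y hy.1 s hs).mono Set.inter_subset_left)
      (fun y hy => ?_) ⟨hx, Metric.mem_ball_self hr⟩ hz
    have := hvε y (hrv ⟨hy.2, hy.1⟩) s hs
    rw [← dist_eq_norm]
    exact le_of_lt this
  have hap : (∫ s in (0 : ℝ)..1, G' (x, s)) (z - x) = ∫ s in (0 : ℝ)..1, G' (x, s) (z - x) :=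
    ContinuousLinearMap.intervalIntegral_apply hint' _
  rw [hap, ← intervalIntegral.integral_sub (hint z hz.1) (hint x hx),
    ← intervalIntegral.integral_sub ((hint z hz.1).sub (hint x hx)) (hint'' _)]
  refine (intervalIntegral.norm_integral_le_of_norm_le_const (C := ε * ‖z - x‖) ?_).trans (by simp)
  intro s hs
  rw [Set.uIoc_of_le zero_le_one] at hs
  exact bound s ⟨hs.1.le, hs.2⟩

theorem contDiffOn_integral [CompleteSpace F] {S : Set E} (hS : Convex ℝ S)
    (hS' : UniqueDiffOn ℝ S) {G : E × ℝ → F}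
    (hG : ContDiffOn ℝ ∞ G (S ×ˢ Set.Icc (0 : ℝ) 1)) :
    ContDiffOn ℝ ∞ (fun z => ∫ s in (0 : ℝ)..1, G (z, s)) S := by
  have hU : UniqueDiffOn ℝ (S ×ˢ Set.Icc (0 : ℝ) 1) := hS'.prod uniqueDiffOn_Icc_zero_one
  -- The induction must vary `F`: the derivative of the integral is an integral of the same kind
  -- with values in `E →L[ℝ] F`, which is why `E` and `F` share a universe.
  suffices H : ∀ n : ℕ, ∀ {F : Type u} [NormedAddCommGroup F] [NormedSpace ℝ F] [CompleteSpace F]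
      {G : E × ℝ → F}, ContDiffOn ℝ ∞ G (S ×ˢ Set.Icc (0 : ℝ) 1) →
      ContDiffOn ℝ n (fun z => ∫ s in (0 : ℝ)..1, G (z, s)) S from
    contDiffOn_infty.2 fun n => H n hG
  have key : ∀ {F : Type u} [NormedAddCommGroup F] [NormedSpace ℝ F] [CompleteSpace F]
      {G : E × ℝ → F}, ContDiffOn ℝ ∞ G (S ×ˢ Set.Icc (0 : ℝ) 1) →
      ContDiffOn ℝ ∞ (fun q => (fderivWithin ℝ G (S ×ˢ Set.Icc (0 : ℝ) 1) q).comp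
        (ContinuousLinearMap.inl ℝ E ℝ)) (S ×ˢ Set.Icc (0 : ℝ) 1) ∧ ∀ x ∈ S,
      HasFDerivWithinAt (fun z => ∫ s in (0 : ℝ)..1, G (z, s))
        (∫ s in (0 : ℝ)..1, (fderivWithin ℝ G (S ×ˢ Set.Icc (0 : ℝ) 1) (x, s)).comp
          (ContinuousLinearMap.inl ℝ E ℝ)) S x := by
    intro F _ _ _ G hG
    have h1 : ContDiffOn ℝ ∞ (fun q => (fderivWithin ℝ G (S ×ˢ Set.Icc (0 : ℝ) 1) q).comp
        (ContinuousLinearMap.inl ℝ E ℝ)) (S ×ˢ Set.Icc (0 : ℝ) 1) :=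
      (hG.fderivWithin hU (by simp)).clm_comp contDiffOn_const
    refine ⟨h1, fun x hx => hasFDerivWithinAt_integral_of_continuousOn hS hG.continuousOn
      h1.continuousOn (fun y hy s hs => ?_) hx⟩
    have h2 := (hG.differentiableOn (by simp) (y, s) ⟨hy, hs⟩).hasFDerivWithinAt
    exact h2.comp y (t := S ×ˢ Set.Icc (0 : ℝ) 1) (f := fun z => (z, s))
      (hasFDerivAt_prodMk_left y s).hasFDerivWithinAt fun z hz => ⟨hz, hs⟩
  intro n
  induction n with
  | zero =>
    intro F _ _ _ G hG
    exact contDiffOn_zero.2 fun x hx => ((key hG).2 x hx).continuousWithinAt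
  | succ n ih =>
    intro F _ _ _ G hG
    push_cast
    rw [contDiffOn_succ_iff_fderivWithin hS']
    refine ⟨fun x hx => ((key hG).2 x hx).differentiableWithinAt, by simp, ?_⟩
    refine (ih (key hG).1).congr fun x hx => ?_
    exact ((key hG).2 x hx).fderivWithin (hS' x hx)

/-- Hadamard's lemma, on a convex set stable under the contraction onto `ker ℓ` along `e`. -/
theorem exists_contDiffOn_eq_smul [CompleteSpace F] {C : Set E} (hC : Convex ℝ C)
    (hC' : (interior C).Nonempty) (ℓ : E →L[ℝ] ℝ) {e : E} (he : ℓ e = 1)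
    (hCe : ∀ z ∈ C, ∀ s ∈ Set.Icc (0 : ℝ) 1, z - ((1 - s) * ℓ z) • e ∈ C)
    {z₀ : E} (hz₀' : ℓ z₀ = 0) {u : Set E} (hu : u ∈ 𝓝 z₀) {f : E → F}
    (hf : ContDiffOn ℝ ∞ f (C ∩ u)) (hf0 : ∀ z ∈ C ∩ u, ℓ z = 0 → f z = 0) :
    ∃ v, IsOpen v ∧ z₀ ∈ v ∧ ∃ g : E → F, ContDiffOn ℝ ∞ g (C ∩ v) ∧
      ∀ z ∈ C ∩ v, f z = ℓ z • g z := by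
  obtain ⟨r, hr, hru⟩ := Metric.mem_nhds_iff.1 hu
  set T : Set E := C ∩ Metric.ball z₀ r with hT
  have hTU : UniqueDiffOn ℝ T := (uniqueDiffOn_convex hC hC').inter Metric.isOpen_ball
  have hfT : ContDiffOn ℝ ∞ f T := hf.mono (Set.inter_subset_inter_right _ hru)
  -- The contraction increases the distance to z₀ by at most the factor κ, so starting in the ball
  -- of radius r/κ keeps it in the ball of radius r.
  set κ : ℝ := 1 + ‖ℓ‖ * ‖e‖ with hκ
  have hκ0 : 0 < κ := by positivity
  set S : Set E := C ∩ Metric.ball z₀ (r / κ) with hSdef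
  have hS : Convex ℝ S := hC.inter (convex_ball _ _)
  have hSU : UniqueDiffOn ℝ S := (uniqueDiffOn_convex hC hC').inter Metric.isOpen_ball
  have hmaps : ∀ z ∈ S, ∀ s ∈ Set.Icc (0 : ℝ) 1, z - ((1 - s) * ℓ z) • e ∈ T := by
    intro z hz s hs
    refine ⟨hCe z hz.1 s hs, ?_⟩
    have hz2 : ‖z - z₀‖ < r / κ := by simpa [dist_eq_norm] using hz.2
    rw [Metric.mem_ball, dist_eq_norm]
    have hl : ‖ℓ z‖ ≤ ‖ℓ‖ * ‖z - z₀‖ := by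
      have := ℓ.le_opNorm (z - z₀)
      rwa [map_sub, hz₀', sub_zero] at this
    have h1s : ‖1 - s‖ ≤ 1 := by
      rw [Real.norm_eq_abs, abs_le]; constructor <;> linarith [hs.1, hs.2]
    calc ‖z - ((1 - s) * ℓ z) • e - z₀‖ = ‖(z - z₀) - ((1 - s) * ℓ z) • e‖ := by congr 1; abel
      _ ≤ ‖z - z₀‖ + ‖((1 - s) * ℓ z) • e‖ := norm_sub_le _ _
      _ ≤ ‖z - z₀‖ + 1 * (‖ℓ‖ * ‖z - z₀‖) * ‖e‖ := by
        rw [norm_smul, norm_mul]; gcongr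
      _ = κ * ‖z - z₀‖ := by rw [hκ]; ring
      _ < κ * (r / κ) := by gcongr
      _ = r := by field_simp
  have hG : ContDiffOn ℝ ∞ (fun q : E × ℝ => fderivWithin ℝ f T (q.1 - ((1 - q.2) * ℓ q.1) • e) e)
      (S ×ˢ Set.Icc (0 : ℝ) 1) := by
    refine ContDiffOn.clm_apply ?_ contDiffOn_const
    refine (hfT.fderivWithin hTU (m := ∞) (by simp)).comp (ContDiff.contDiffOn (by fun_prop)) ?_
    exact fun q hq => hmaps q.1 hq.1 q.2 hq.2
  -- The quotient is the mean of the derivative of f along e over the segment from the projection of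
  -- z to ker ℓ (s = 0) up to z (s = 1). The segment has velocity ℓ(z)e and f vanishes at its start,
  -- so the fundamental theorem of calculus gives f(z) = ℓ(z)g(z).
  refine ⟨Metric.ball z₀ (r / κ), Metric.isOpen_ball, Metric.mem_ball_self (by positivity), _,
    contDiffOn_integral hS hSU hG, fun z hz => ?_⟩
  have hcurve : ∀ s ∈ Set.Icc (0 : ℝ) 1, HasDerivWithinAt
      (fun s : ℝ => f (z - ((1 - s) * ℓ z) • e))
      (ℓ z • fderivWithin ℝ f T (z - ((1 - s) * ℓ z) • e) e) (Set.Icc 0 1) s := by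
    intro s hs
    have h1 := (hfT.differentiableOn (by simp) _ (hmaps z hz s hs)).hasFDerivWithinAt
    have h2 : HasDerivWithinAt (fun s : ℝ => z - ((1 - s) * ℓ z) • e) (ℓ z • e)
        (Set.Icc 0 1) s := by
      have := ((((hasDerivAt_id s).const_sub 1).mul_const (ℓ z)).smul_const e).const_sub z
      simpa using this.hasDerivWithinAt
    have := h1.comp_hasDerivWithinAt s h2 fun s hs => hmaps z hz s hs
    simpa [Function.comp_def] using this
  have hcont : ContinuousOn (fun s : ℝ => ℓ z • fderivWithin ℝ f T (z - ((1 - s) * ℓ z) • e) e)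
      (Set.Icc 0 1) :=
    (hG.continuousOn.comp (f := fun s : ℝ => (z, s)) (by fun_prop)
      (fun s hs => ⟨hz, hs⟩)).const_smul (ℓ z)
  have hftc := intervalIntegral.integral_eq_sub_of_hasDerivAt_of_le zero_le_one
    (fun s hs => (hcurve s hs).continuousWithinAt)
    (fun s hs => (hcurve s ⟨hs.1.le, hs.2.le⟩).hasDerivAt (Icc_mem_nhds hs.1 hs.2))
    (by
      apply ContinuousOn.intervalIntegrable
      rwa [Set.uIcc_of_le zero_le_one])
  have h0 : f (z - ((1 - (0 : ℝ)) * ℓ z) • e) = 0 := by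
    have := hmaps z hz 0 ⟨le_rfl, zero_le_one⟩
    refine hf0 _ ⟨this.1, hru this.2⟩ ?_
    simp [he]
  rw [h0, intervalIntegral.integral_smul] at hftc
  simpa using hftc.symm

end Calculus

/-! ### Division by a complex linear coordinate -/

section Division

variable {E : Type} [NormedAddCommGroup E] [NormedSpace ℝ E]

/-- A smooth complex function whose pairing with a linear coordinate `A` has no real part is the
product of `iA` and a smooth real function. -/
theorem exists_contDiffOn_eq_I_mul (A : E →L[ℝ] ℂ) (hA : Function.Surjective A) {z₀ : E}
    (hz₀ : A z₀ = 0) {u : Set E} (hu : u ∈ 𝓝 z₀) {ζ : E → ℂ} (hζ : ContDiffOn ℝ ∞ ζ u)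
    (h : ∀ z ∈ u, (conj (A z) * ζ z).re = 0) :
    ∃ v, IsOpen v ∧ z₀ ∈ v ∧ ∃ b : E → ℝ, ContDiffOn ℝ ∞ b v ∧
      ∀ z ∈ v, ζ z = Complex.I * b z * A z := by
  obtain ⟨e₁, he₁⟩ := hA 1
  obtain ⟨e₂, he₂⟩ := hA Complex.I
  have h' : ∀ z ∈ u, (A z).re * (ζ z).re + (A z).im * (ζ z).im = 0 := by
    intro z hz
    have := h z hz
    simpa [Complex.mul_re] using this
  -- A continuous function that vanishes on a punctured line segment through z vanishes at z. It is
  -- used along e₁ and e₂ to reach the points where a factor cannot be cancelled.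
  have vanish : ∀ (e : E), A e ≠ 0 → ∀ (φ : E → ℝ) (w : Set E), IsOpen w → ContinuousOn φ w →
      ∀ z ∈ w, (∀ t : ℝ, t ≠ 0 → z + t • e ∈ w → φ (z + t • e) = 0) → φ z = 0 := by
    intro e _ φ w hw hφ z hz hφ0
    have hc : ContinuousAt (fun t : ℝ => φ (z + t • e)) 0 := by
      have h1 : ContinuousAt φ (z + (0 : ℝ) • e) := by
        simpa using hφ.continuousAt (hw.mem_nhds hz)
      exact ContinuousAt.comp (f := fun t : ℝ => z + t • e) h1 (by fun_prop)
    have hw' : ∀ᶠ t : ℝ in 𝓝 0, z + t • e ∈ w := by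
      have : ContinuousAt (fun t : ℝ => z + t • e) 0 := by fun_prop
      exact this.eventually_mem (hw.mem_nhds (by simpa using hz))
    have h2 : Filter.Tendsto (fun t : ℝ => φ (z + t • e)) (𝓝[≠] 0) (𝓝 0) := by
      refine tendsto_const_nhds.congr' ?_
      filter_upwards [hw'.filter_mono nhdsWithin_le_nhds, self_mem_nhdsWithin] with t ht ht0
      exact (hφ0 t ht0 ht).symm
    have h3 := tendsto_nhds_unique (hc.tendsto.mono_left nhdsWithin_le_nhds) h2
    simpa using h3
  obtain ⟨w, hwu, hw, hz₀w⟩ := mem_nhds_iff.1 hu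
  have hre : ContDiffOn ℝ ∞ (fun z => (ζ z).re) w := Complex.reCLM.contDiff.comp_contDiffOn (hζ.mono hwu)
  have him : ContDiffOn ℝ ∞ (fun z => (ζ z).im) w := Complex.imCLM.contDiff.comp_contDiffOn (hζ.mono hwu)
  -- Where Im A = 0 the hypothesis reads Re A · Re ζ = 0. Zeros of Re A are approached along e₁,
  -- which changes Re A and keeps Im A = 0. Hadamard's lemma then divides Re ζ by Im A.
  have hre0 : ∀ z ∈ w, (A z).im = 0 → (ζ z).re = 0 := by
    intro z hz hAz
    by_cases hz' : (A z).re = 0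
    · refine vanish e₁ (by simp [he₁]) _ w hw hre.continuousOn z hz fun t ht htw => ?_
      have := h' _ (hwu htw)
      simpa [he₁, hAz, hz', ht] using this
    · have := h' z (hwu hz)
      simpa [hAz, hz'] using this
  obtain ⟨v, hv, hz₀v, b, hb, hbv⟩ := exists_contDiffOn_eq_smul (C := Set.univ) convex_univ
    (by simp) (Complex.imCLM ∘L A) (e := e₂) (by simp [he₂]) (fun _ _ _ _ => Set.mem_univ _)
    (z₀ := z₀) (by simp [hz₀]) (hw.mem_nhds hz₀w) (f := fun z => (ζ z).re)
    (hre.mono Set.inter_subset_right) (fun z hz hz' => hre0 z hz.2 hz')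
  rw [Set.univ_inter] at hb
  refine ⟨v ∩ w, hv.inter hw, ⟨hz₀v, hz₀w⟩, fun z => -b z, (hb.mono Set.inter_subset_left).neg,
    fun z hz => ?_⟩
  have e1 : ∀ z ∈ v ∩ w, (ζ z).re = (A z).im * b z := fun z hz => by
    simpa using hbv z ⟨trivial, hz.1⟩
  have e2 : ∀ z ∈ v ∩ w, (A z).im ≠ 0 → (ζ z).im + (A z).re * b z = 0 := fun z hz hne => by
    have := h' z (hwu hz.2)
    rw [e1 z hz] at this
    have h4 : (A z).im * ((ζ z).im + (A z).re * b z) = 0 := by linarith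
    exact (mul_eq_zero.1 h4).resolve_left hne
  -- The same quotient b serves the imaginary part: cancel Im A where it is nonzero, and approach
  -- its zeros along e₂, on which Im A is nonconstant.
  have e3 : (ζ z).im + (A z).re * b z = 0 := by
    by_cases hne : (A z).im = 0
    · refine vanish e₂ (by simp [he₂]) (fun z => (ζ z).im + (A z).re * b z) (v ∩ w) (hv.inter hw)
        ?_ z hz fun t ht htw => e2 _ htw ?_
      · refine (him.continuousOn.mono Set.inter_subset_right).add (ContinuousOn.mul ?_
          (hb.continuousOn.mono Set.inter_subset_left))
        fun_prop
      · simpa [he₂, hne] using ht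
    · exact e2 z hz hne
  apply Complex.ext
  · simp [e1 z hz]; ring
  · simp; linarith

end Division

/-! ### Directional derivatives and cutoff functions -/

section Utilities

variable {E : Type*} [NormedAddCommGroup E] [NormedSpace ℝ E] {H : Type*} [TopologicalSpace H]
  {I : ModelWithCorners ℝ E H} {M : Type*} [TopologicalSpace M] [ChartedSpace H M]
  {F : Type*} [NormedAddCommGroup F] [NormedSpace ℝ F]

/-- The derivative at `q` of a vector-valued function along the tangent vector `v`. -/
def dirDeriv (I : ModelWithCorners ℝ E H) (f : M → F) (q : M) (v : TangentSpace I q) : F :=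
  mfderiv I 𝓘(ℝ, F) f q v

theorem dirDeriv_smul_vec (f : M → F) (q : M) (c : ℝ) (v : TangentSpace I q) :
    dirDeriv I f q (c • v) = c • dirDeriv I f q v :=
  map_smul (mfderiv I 𝓘(ℝ, F) f q) c v

theorem dirDeriv_zero_vec (f : M → F) (q : M) : dirDeriv I f q (0 : TangentSpace I q) = 0 :=
  map_zero (mfderiv I 𝓘(ℝ, F) f q)

theorem dirDeriv_sum_vec {ι : Type*} (s : Finset ι) (f : M → F) (q : M)
    (v : ι → TangentSpace I q) :
    dirDeriv I f q (∑ i ∈ s, v i) = ∑ i ∈ s, dirDeriv I f q (v i) :=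
  map_sum (mfderiv I 𝓘(ℝ, F) f q) v s

theorem dirDeriv_congr {f g : M → F} {q : M} (h : f =ᶠ[𝓝 q] g) (v : TangentSpace I q) :
    dirDeriv I f q v = dirDeriv I g q v :=
  congrArg (fun L : TangentSpace I q →L[ℝ] F => L v) (h.mfderiv_eq (I := I) (I' := 𝓘(ℝ, F)))

theorem dirDeriv_mul {A : Type*} [NormedRing A] [NormedAlgebra ℝ A] {f g : M → A} {q : M}
    (hf : MDifferentiableAt I 𝓘(ℝ, A) f q) (hg : MDifferentiableAt I 𝓘(ℝ, A) g q)
    (v : TangentSpace I q) :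
    dirDeriv I (fun x => f x * g x) q v = f q * dirDeriv I g q v + dirDeriv I f q v * g q := by
  have h := (hf.hasMFDerivAt.mul' hg.hasMFDerivAt).mfderiv
  exact congrArg (fun L : TangentSpace I q →L[ℝ] A => L v) h

theorem dirDeriv_clm_comp {G : Type*} [NormedAddCommGroup G] [NormedSpace ℝ G] (L : F →L[ℝ] G)
    {f : M → F} {q : M} (hf : MDifferentiableAt I 𝓘(ℝ, F) f q) (v : TangentSpace I q) :
    dirDeriv I (fun x => L (f x)) q v = L (dirDeriv I f q v) := by
  have h := (L.hasMFDerivAt (x := f q)).comp q hf.hasMFDerivAt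
  exact congrArg (fun L : TangentSpace I q →L[ℝ] G => L v) h.mfderiv

theorem dirDeriv_comp {E' : Type*} [NormedAddCommGroup E'] [NormedSpace ℝ E'] {H' : Type*}
    [TopologicalSpace H'] {I' : ModelWithCorners ℝ E' H'} {N : Type*} [TopologicalSpace N]
    [ChartedSpace H' N] {j : N → M} {n : N} {f : M → F}
    (hf : MDifferentiableAt I 𝓘(ℝ, F) f (j n)) (hj : MDifferentiableAt I' I j n)
    (v : TangentSpace I' n) :
    dirDeriv I' (fun x => f (j x)) n v = dirDeriv I f (j n) (mfderiv I' I j n v) := by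
  have h := (hf.hasMFDerivAt.comp n hj.hasMFDerivAt).mfderiv
  exact congrArg (fun L : TangentSpace I' n →L[ℝ] F => L v) h

theorem contMDiffAt_dirDeriv [IsManifold I ∞ M] {f : M → F} {q : M}
    (hf : ContMDiffAt I 𝓘(ℝ, F) ∞ f q) {X : ∀ p : M, TangentSpace I p}
    (hX : ContMDiffAt I I.tangent ∞ (fun p => (⟨p, X p⟩ : TangentBundle I M)) q) :
    ContMDiffAt I 𝓘(ℝ, F) ∞ (fun p => dirDeriv I f p (X p)) q := by
  have : IsManifold I 1 M := IsManifold.of_le (n := ∞) (by simp)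
  have h1 := hf.mfderiv_const (m := ∞) (by simp)
  have h2 := ContMDiffAt.clm_apply_of_inCoordinates (b₁ := id) (b₂ := f) (v := X)
    (ϕ := fun p => mfderiv I 𝓘(ℝ, F) f p) h1 hX hf
  exact (contMDiff_snd_tangentBundle_modelSpace F 𝓘(ℝ, F)).contMDiffAt.comp q h2

theorem VField.contMDiffAt_dirDeriv [IsManifold I ∞ M] (X : VField I M) {f : M → F} {q : M}
    (hf : ContMDiffAt I 𝓘(ℝ, F) ∞ f q) :
    ContMDiffAt I 𝓘(ℝ, F) ∞ (fun p => dirDeriv I f p (X p)) q :=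
  EllipticGeometry.contMDiffAt_dirDeriv hf X.contMDiff.contMDiffAt

theorem exists_smoothFun_eventuallyEq_one [FiniteDimensional ℝ E] [T2Space M] [IsManifold I ∞ M]
    {p : M} {O : Set M} (hO : O ∈ 𝓝 p) :
    ∃ χ : SmoothFun I M, (∀ᶠ q in 𝓝 p, χ q = 1) ∧ tsupport χ ⊆ O := by
  obtain ⟨χ, -, hχ⟩ := (SmoothBumpFunction.nhds_basis_tsupport (I := I) p).mem_iff.1 hO
  exact ⟨⟨χ, χ.contMDiff⟩, χ.eventuallyEq_one, hχ⟩

theorem contMDiff_smul_of_tsupport [IsManifold I ∞ M] (χ : SmoothFun I M) {f : M → F}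
    (h : ∀ p ∈ tsupport χ, ContMDiffAt I 𝓘(ℝ, F) ∞ f p) :
    ContMDiff I 𝓘(ℝ, F) ∞ (fun q => χ q • f q) := by
  refine contMDiff_of_tsupport fun x hx => ?_
  exact χ.contMDiff.contMDiffAt.smul (h x (tsupport_smul_subset_left _ _ hx))

theorem exists_contMDiff_eventuallyEq [FiniteDimensional ℝ E] [T2Space M] [IsManifold I ∞ M]
    {p : M} {f : M → F} (h : ∀ᶠ q in 𝓝 p, ContMDiffAt I 𝓘(ℝ, F) ∞ f q) :
    ∃ g : M → F, ContMDiff I 𝓘(ℝ, F) ∞ g ∧ ∀ᶠ q in 𝓝 p, g q = f q := by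
  obtain ⟨χ, hχ1, hχ⟩ := exists_smoothFun_eventuallyEq_one (I := I) h
  refine ⟨_, contMDiff_smul_of_tsupport χ fun q hq => hχ hq, ?_⟩
  filter_upwards [hχ1] with q hq
  rw [hq, one_smul]

theorem exists_smoothFun_eventuallyEq [FiniteDimensional ℝ E] [T2Space M] [IsManifold I ∞ M]
    {p : M} {f : M → ℝ} (h : ∀ᶠ q in 𝓝 p, ContMDiffAt I 𝓘(ℝ, ℝ) ∞ f q) :
    ∃ g : SmoothFun I M, ∀ᶠ q in 𝓝 p, g q = f q := by
  obtain ⟨g, hg, hgf⟩ := exists_contMDiff_eventuallyEq h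
  exact ⟨⟨g, hg⟩, hgf⟩

end Utilities

/-! ### Evaluation of sections in the fibres 𝓔 / 𝔪_p 𝓔 -/

section Fibres

variable {E : Type*} [NormedAddCommGroup E] [NormedSpace ℝ E] {H : Type*} [TopologicalSpace H]
  {I : ModelWithCorners ℝ E H} {M : Type*} [TopologicalSpace M] [ChartedSpace H M]
  [IsManifold I ∞ M] (𝓔 : Submodule (SmoothFun I M) (VField I M))

theorem fibreEval_surjective (p : M) : Function.Surjective (fibreEval 𝓔 p) :=
  Submodule.mkQ_surjective _

theorem anchor_fibreEval (p : M) (X : 𝓔) : anchor 𝓔 p (fibreEval 𝓔 p X) = (X : VField I M) p :=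
  rfl

theorem fibreEval_smul_of_eq_zero {p : M} {f : SmoothFun I M} (hf : f p = 0) (X : 𝓔) :
    fibreEval 𝓔 p (f • X) = 0 := by
  refine (Submodule.Quotient.mk_eq_zero _).2 ?_
  refine Submodule.smul_mem_smul (I := (vanishingIdeal {p} : Ideal (SmoothFun I M))) ?_
    Submodule.mem_top
  intro q hq
  rw [Set.mem_singleton_iff.1 hq, hf]

/-- The difference `f - f p` lies in 𝔪_p, so it acts as zero on the fibre. -/
theorem fibreEval_smul (p : M) (f : SmoothFun I M) (X : 𝓔) :
    fibreEval 𝓔 p (f • X) = f p • fibreEval 𝓔 p X := by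
  let g : SmoothFun I M := ⟨fun q => f q - f p, f.contMDiff.sub contMDiff_const⟩
  have hg : g p = 0 := sub_self _
  have h : f • X = g • X + f p • X := by
    ext q
    change f q • (X : VField I M) q = (f q - f p) • (X : VField I M) q + f p • (X : VField I M) q
    rw [← add_smul, sub_add_cancel]
  calc fibreEval 𝓔 p (f • X) = fibreEval 𝓔 p (g • X) + fibreEval 𝓔 p (f p • X) := by
        rw [h, map_add]
    _ = f p • fibreEval 𝓔 p X := by
        rw [fibreEval_smul_of_eq_zero 𝓔 hg, zero_add]
        exact map_smul (fibreEval 𝓔 p) (f p) X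

variable [FiniteDimensional ℝ E] [T2Space M]

/-- A cutoff χ supported where X vanishes, with χ(p) = 1, has χX = 0, while χX and X have the same
value in the fibre at p. So fibre values depend only on germs. -/
theorem fibreEval_eq_zero_of_eventually {p : M} {X : 𝓔}
    (h : ∀ᶠ q in 𝓝 p, (X : VField I M) q = 0) : fibreEval 𝓔 p X = 0 := by
  obtain ⟨χ, hχ1, hχ⟩ := exists_smoothFun_eventuallyEq_one (I := I) h
  have : χ • X = 0 := by
    ext q
    change χ q • (X : VField I M) q = 0
    by_cases hq : q ∈ tsupport χ
    · exact (congrArg (χ q • ·) (hχ hq)).trans (smul_zero _)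
    · exact (congrArg (· • (X : VField I M) q) (image_eq_zero_of_notMem_tsupport hq)).trans
        (zero_smul _ _)
  have h2 := fibreEval_smul 𝓔 p χ X
  rw [this, map_zero, hχ1.self_of_nhds, one_smul] at h2
  exact h2.symm

/-- Turns a local identity between vector fields into an identity in the fibre, also at points where
the anchor loses information. -/
theorem fibreEval_eq_sum {ι : Type*} [Fintype ι] {p : M} {X : 𝓔} {g : ι → SmoothFun I M}
    {e : ι → 𝓔} (h : ∀ᶠ q in 𝓝 p, (X : VField I M) q = ∑ i, g i q • (e i : VField I M) q) :
    fibreEval 𝓔 p X = ∑ i, g i p • fibreEval 𝓔 p (e i) := by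
  have h0 : fibreEval 𝓔 p (X - ∑ i, g i • e i) = 0 := by
    refine fibreEval_eq_zero_of_eventually 𝓔 ?_
    filter_upwards [h] with q hq
    have hs : tangentEval 𝓔 q (∑ i, g i • e i) = ∑ i, g i q • (e i : VField I M) q :=
      map_sum (tangentEval 𝓔 q) _ _
    have := map_sub (tangentEval 𝓔 q) X (∑ i, g i • e i)
    rw [hs] at this
    exact this.trans (sub_eq_zero.2 hq)
  rw [map_sub, sub_eq_zero, map_sum] at h0
  simpa only [fibreEval_smul] using h0

end Fibres

theorem dirDeriv_normSq {E : Type*} [NormedAddCommGroup E] [NormedSpace ℝ E] {H : Type*}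
    [TopologicalSpace H] {I : ModelWithCorners ℝ E H} {M : Type*} [TopologicalSpace M]
    [ChartedSpace H M] {f : M → ℂ} {q : M} (hf : MDifferentiableAt I 𝓘(ℝ, ℂ) f q)
    (v : TangentSpace I q) :
    dirDeriv I (fun x => Complex.normSq (f x)) q v = 2 * (conj (f q) * dirDeriv I f q v).re := by
  have h1 : (fun x => Complex.normSq (f x)) =
      fun x => Complex.reCLM (Complex.conjCLE.toContinuousLinearMap (f x) * f x) := by
    ext x
    simp [Complex.normSq_apply]
  have hc : MDifferentiableAt I 𝓘(ℝ, ℂ)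
      (fun x => Complex.conjCLE.toContinuousLinearMap (f x)) q :=
    (Complex.conjCLE.toContinuousLinearMap.hasMFDerivAt (x := f q)).mdifferentiableAt.comp q hf
  have hm : MDifferentiableAt I 𝓘(ℝ, ℂ)
      (fun x => Complex.conjCLE.toContinuousLinearMap (f x) * f x) q :=
    (hc.hasMFDerivAt.mul' hf.hasMFDerivAt).mdifferentiableAt
  rw [h1, dirDeriv_clm_comp Complex.reCLM hm, dirDeriv_mul hc hf, dirDeriv_clm_comp _ hf]
  simp [Complex.mul_re]
  ring

theorem contMDiffAt_normSq {E : Type*} [NormedAddCommGroup E] [NormedSpace ℝ E] {H : Type*}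
    [TopologicalSpace H] {I : ModelWithCorners ℝ E H} {M : Type*} [TopologicalSpace M]
    [ChartedSpace H M] {f : M → ℂ} {q : M} (hf : ContMDiffAt I 𝓘(ℝ, ℂ) ∞ f q) :
    ContMDiffAt I 𝓘(ℝ, ℝ) ∞ (fun x => Complex.normSq (f x)) q := by
  have h : ContDiff ℝ ∞ (fun z : ℂ => Complex.normSq z) := by
    simp only [Complex.normSq_apply]
    exact (Complex.reCLM.contDiff.mul Complex.reCLM.contDiff).add
      (Complex.imCLM.contDiff.mul Complex.imCLM.contDiff)
  exact h.contMDiff.contMDiffAt.comp q hf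

theorem contMDiffAt_complex_div {E : Type*} [NormedAddCommGroup E] [NormedSpace ℝ E] {H : Type*}
    [TopologicalSpace H] {I : ModelWithCorners ℝ E H} {M : Type*} [TopologicalSpace M]
    [ChartedSpace H M] {f g : M → ℂ} {q : M} (hf : ContMDiffAt I 𝓘(ℝ, ℂ) ∞ f q)
    (hg : ContMDiffAt I 𝓘(ℝ, ℂ) ∞ g q) (hq : g q ≠ 0) :
    ContMDiffAt I 𝓘(ℝ, ℂ) ∞ (fun x => f x / g x) q := by
  have h : ContDiffAt ℝ ∞ (fun z : ℂ × ℂ => z.1 * z.2⁻¹) (f q, g q) :=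
    contDiffAt_fst.mul (contDiffAt_snd.fun_inv hq)
  simp only [div_eq_mul_inv]
  exact h.contMDiffAt.comp q (hf.prodMk_space hg)

/-! ### The elliptic ideal in a local trivialisation -/

section Ideal

variable {E : Type*} [NormedAddCommGroup E] [NormedSpace ℝ E] {H : Type*} [TopologicalSpace H]
  {I : ModelWithCorners ℝ E H} {M : Type*} [TopologicalSpace M] [ChartedSpace H M]
  {U : M → Type*} [TopologicalSpace (TotalSpace ℂ U)] [∀ p, AddCommGroup (U p)]
  [∀ p, Module ℂ (U p)] [∀ p, TopologicalSpace (U p)] [FiberBundle ℂ U]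
  [VectorBundle ℝ ℂ U]

set_option linter.unusedSectionVars false

namespace ComplexDivisor

variable (D : ComplexDivisor I U)

/-- The section of a complex divisor in the local trivialisation at `p`. -/
def localRep (p : M) : M → ℂ := fun x => (trivializationAt ℂ U p ⟨x, D.sec x⟩).2

theorem contMDiffAt_localRep [ContMDiffVectorBundle ∞ ℂ U I] {p q : M}
    (hq : q ∈ (trivializationAt ℂ U p).baseSet) :
    ContMDiffAt I 𝓘(ℝ, ℂ) ∞ (D.localRep p) q :=
  ((trivializationAt ℂ U p).contMDiffAt_section_iff hq).1 D.sec.contMDiff.contMDiffAt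

variable [VectorBundle ℂ ℂ U]

theorem localRep_eq_zero_iff {p q : M} (hq : q ∈ (trivializationAt ℂ U p).baseSet) :
    D.localRep p q = 0 ↔ q ∈ D.locus := by
  have h := (trivializationAt ℂ U p).coe_linearMapAt_of_mem (R := ℂ) hq
  have h1 : D.localRep p q = (trivializationAt ℂ U p).linearEquivAt ℂ q hq (D.sec q) := rfl
  rw [h1, LinearEquiv.map_eq_zero_iff]
  rfl

theorem sec_eq_smul {p q : M} (hq : q ∈ (trivializationAt ℂ U p).baseSet) :
    D.sec q = D.localRep p q • (trivializationAt ℂ U p).symm q (1 : ℂ) := by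
  have h1 : D.localRep p q = (trivializationAt ℂ U p).linearEquivAt ℂ q hq (D.sec q) := rfl
  have h2 : (trivializationAt ℂ U p).symm q (1 : ℂ) =
    ((trivializationAt ℂ U p).linearEquivAt ℂ q hq).symm 1 := rfl
  rw [h2, ← map_smul, smul_eq_mul, mul_one, h1, LinearEquiv.symm_apply_apply]

variable [IsManifold I ∞ M] [ContMDiffVectorBundle ∞ ℂ U I]

/-- In the trivialisation τ, the Hermitian field is g · conj(τu) · τv; the support of g allows its
extension by zero. -/
theorem mem_ellipticIdeal_of_eq_mul {p : M} {f g : SmoothFun I M}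
    (hg : tsupport g ⊆ (trivializationAt ℂ U p).baseSet)
    (h : ∀ q, f q = g q * Complex.normSq (D.localRep p q)) : f ∈ D.ellipticIdeal := by
  let τ : ∀ q, U q →ₗ[ℂ] ℂ := fun q => (trivializationAt ℂ U p).linearMapAt ℂ q
  let B : ∀ q, U q →ₗ⋆[ℂ] U q →ₗ[ℂ] ℂ := fun q =>
    LinearMap.mk₂'ₛₗ (starRingEnd ℂ) (RingHom.id ℂ)
      (fun u v => g q • (conj (τ q u) * τ q v))
      (fun u u' v => by rw [map_add, map_add, add_mul, smul_add])
      (fun c u v => by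
        rw [map_smul]; simp only [smul_eq_mul, map_mul, Complex.real_smul]; ring)
      (fun u v v' => by rw [map_add, mul_add, smul_add])
      (fun c u v => by
        rw [map_smul]; simp only [smul_eq_mul, RingHom.id_apply, Complex.real_smul]; ring)
  have hB : ∀ q u v, B q u v = g q • (conj (τ q u) * τ q v) := fun q u v => rfl
  have hτ : ∀ q ∈ (trivializationAt ℂ U p).baseSet, ∀ u : U q,
      τ q u = (trivializationAt ℂ U p ⟨q, u⟩).2 := fun q hq u =>
    congrFun ((trivializationAt ℂ U p).coe_linearMapAt_of_mem (R := ℂ) hq) u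
  refine ⟨⟨B, fun q u v => ?_, fun u => ?_⟩, fun q => ?_⟩
  · rw [hB, hB]
    simp only [Complex.real_smul, map_mul, Complex.conj_ofReal, Complex.conj_conj]
    ring
  · simp only [hB]
    refine contMDiff_smul_of_tsupport g fun q hq => ?_
    have hqW := hg hq
    have h1 : ContMDiffAt I 𝓘(ℝ, ℂ) ∞ (fun x => (trivializationAt ℂ U p ⟨x, u x⟩).2) q :=
      ((trivializationAt ℂ U p).contMDiffAt_section_iff hqW).1 u.contMDiff.contMDiffAt
    have h2 : ContMDiffAt I 𝓘(ℝ, ℂ) ∞ (fun x => τ x (u x)) q := by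
      refine h1.congr_of_eventuallyEq ?_
      filter_upwards [(trivializationAt ℂ U p).open_baseSet.mem_nhds hqW] with x hx
      exact hτ x hx _
    have h3 : ContDiff ℝ ∞ (fun z : ℂ => conj z * z) :=
      Complex.conjCLE.contDiff.mul contDiff_id
    exact h3.contMDiff.contMDiffAt.comp q h2
  · change ((f q : ℝ) : ℂ) = B q (D.sec q) (D.sec q)
    rw [hB, h q]
    by_cases hq : q ∈ (trivializationAt ℂ U p).baseSet
    · have h4 : τ q (D.sec q) = D.localRep p q := hτ q hq _
      rw [h4, ← Complex.normSq_eq_conj_mul_self, Complex.real_smul, Complex.ofReal_mul]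
    · rw [image_eq_zero_of_notMem_tsupport fun hq' => hq (hg hq')]
      simp

/-- With a local unit frame u and s = σu, one has h(s, s) = |σ|² h(u, u). Smoothness of h is tested
on global sections only, so u is cut off by χ, and the factorisation holds where χ = 1. -/
theorem exists_eq_mul_of_mem_ellipticIdeal {p : M} {χ : SmoothFun I M}
    (hχ : tsupport χ ⊆ (trivializationAt ℂ U p).baseSet) {f : SmoothFun I M}
    (hf : f ∈ D.ellipticIdeal) :
    ∃ g : SmoothFun I M, ∀ q, χ q = 1 → f q = g q * Complex.normSq (D.localRep p q) := by
  obtain ⟨h, hh⟩ := hf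
  have hsymm : ContMDiffOn I (I.prod 𝓘(ℝ, ℂ)) ∞
      (fun x => (⟨x, (trivializationAt ℂ U p).symm x (1 : ℂ)⟩ : TotalSpace ℂ U))
      (trivializationAt ℂ U p).baseSet := by
    rw [(trivializationAt ℂ U p).contMDiffOn_section_baseSet_iff]
    refine (contMDiffOn_const (c := (1 : ℂ))).congr fun x hx => ?_
    rw [Trivialization.apply_mk_symm _ hx]
  let u : Cₛ^∞⟮I; ℂ, U⟯ := ⟨fun x => χ x • (trivializationAt ℂ U p).symm x (1 : ℂ),
    ContMDiffOn.smul_section_of_tsupport χ.contMDiff.contMDiffOn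
      (trivializationAt ℂ U p).open_baseSet hχ hsymm⟩
  refine ⟨⟨fun x => (h.form x (u x) (u x)).re,
    Complex.reCLM.contDiff.contMDiff.comp (h.smooth u)⟩, fun q hq => ?_⟩
  have hqW : q ∈ (trivializationAt ℂ U p).baseSet :=
    hχ (subset_tsupport _ (by simp [hq]))
  have hu : u q = (trivializationAt ℂ U p).symm q (1 : ℂ) := by
    change χ q • (trivializationAt ℂ U p).symm q (1 : ℂ) = _
    rw [hq, one_smul]
  have hs : D.sec q = D.localRep p q • u q := by rw [hu]; exact D.sec_eq_smul hqW
  have hr : ((h.form q (u q) (u q)).re : ℂ) = h.form q (u q) (u q) :=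
    Complex.conj_eq_iff_re.1 (h.hermitian q _ _)
  apply Complex.ofReal_injective
  change ((f q : ℝ) : ℂ) = (((h.form q (u q) (u q)).re * Complex.normSq (D.localRep p q) : ℝ) : ℂ)
  rw [hh q, Complex.ofReal_mul, hr, Complex.normSq_eq_conj_mul_self, hs]
  simp only [LinearMap.map_smulₛₗ, LinearMap.smul_apply, RingHom.id_apply, smul_eq_mul]
  ring

/-- If f = g|σ|² and X(σ) = cσ, then X(f) = (X(g) + 2 Re(c) g)|σ|². The closed set K carries both X
and c and lies where χ is locally 1, so the new factor is supported in the trivialising set. -/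
theorem mem_ellipticFields_of_eq_mul {p : M} {χ : SmoothFun I M}
    (hχ : tsupport χ ⊆ (trivializationAt ℂ U p).baseSet) {K : Set M} (hK : IsClosed K)
    (hKχ : ∀ q ∈ K, ∀ᶠ x in 𝓝 q, χ x = 1) {X : VField I M} (hX : ∀ q ∉ K, X q = 0)
    {c : M → ℂ} (hc : ContMDiff I 𝓘(ℝ, ℂ) ∞ c) (hc0 : ∀ q ∉ K, c q = 0)
    (h : ∀ q ∈ K, dirDeriv I (D.localRep p) q (X q) = c q * D.localRep p q) :
    X ∈ D.ellipticFields := by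
  intro f hf
  obtain ⟨g, hg⟩ := D.exists_eq_mul_of_mem_ellipticIdeal hχ hf
  let k : SmoothFun I M := ⟨fun q => dirDeriv I g q (X q) + 2 * (c q).re * g q, fun q =>
    (X.contMDiffAt_dirDeriv g.contMDiff.contMDiffAt).add
      ((contMDiffAt_const.mul (Complex.reCLM.contDiff.contMDiff.comp hc).contMDiffAt).mul
        g.contMDiff.contMDiffAt)⟩
  let f' : SmoothFun I M := ⟨fun q => dirDeriv I f q (X q), fun q =>
    X.contMDiffAt_dirDeriv f.contMDiff.contMDiffAt⟩
  have hKW : K ⊆ (trivializationAt ℂ U p).baseSet := fun q hq =>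
    hχ (subset_tsupport _ (by simp [(hKχ q hq).self_of_nhds]))
  have hk0 : ∀ q ∉ K, k q = 0 := fun q hq => by
    change dirDeriv I g q (X q) + 2 * (c q).re * g q = 0
    rw [hX q hq, hc0 q hq]
    have := dirDeriv_zero_vec (I := I) g q
    simp [this]
  refine ⟨f', D.mem_ellipticIdeal_of_eq_mul (p := p) (g := k) ?_ fun q => ?_, fun q => rfl⟩
  · refine (closure_minimal (fun q hq => ?_) hK).trans hKW
    by_contra hqK
    exact hq (hk0 q hqK)
  · change dirDeriv I f q (X q) = k q * _
    by_cases hq : q ∈ K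
    · have hd : MDifferentiableAt I 𝓘(ℝ, ℂ) (D.localRep p) q :=
        (D.contMDiffAt_localRep (hKW hq)).mdifferentiableAt (by simp)
      have hn : MDifferentiableAt I 𝓘(ℝ, ℝ) (fun x => Complex.normSq (D.localRep p x)) q :=
        (contMDiffAt_normSq (D.contMDiffAt_localRep (hKW hq))).mdifferentiableAt (by simp)
      have hgd : MDifferentiableAt I 𝓘(ℝ, ℝ) g q :=
        g.contMDiff.contMDiffAt.mdifferentiableAt (by simp)
      have he : (f : M → ℝ) =ᶠ[𝓝 q] fun x => g x * Complex.normSq (D.localRep p x) := by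
        filter_upwards [hKχ q hq] with x hx using hg x hx
      rw [dirDeriv_congr he, dirDeriv_mul hgd hn, dirDeriv_normSq hd, h q hq]
      change _ = (dirDeriv I g q (X q) + 2 * (c q).re * g q) * _
      have : (conj (D.localRep p q) * (c q * D.localRep p q)).re =
          (c q).re * Complex.normSq (D.localRep p q) := by
        simp [Complex.normSq_apply, Complex.mul_re, Complex.mul_im]; ring
      rw [this]; ring
    · rw [hk0 q hq, zero_mul, hX q hq]
      exact dirDeriv_zero_vec _ _

end ComplexDivisor

end Ideal

/-! ### Coordinates in which a submersion to ℂ is linear -/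

section Straightening

/-- Near a point at which a smooth complex function is a submersion, there are smooth coordinates
in which the function is linear. -/
theorem exists_openPartialHomeomorph_eq_linear {E : Type*} [NormedAddCommGroup E]
    [NormedSpace ℝ E] [CompleteSpace E] {O : Set E} (hO : IsOpen O) {z₀ : E}
    (hz₀ : z₀ ∈ O) {σ : E → ℂ} (hσ : ContDiffOn ℝ ∞ σ O)
    (hs : Function.Surjective (fderiv ℝ σ z₀)) :
    ∃ Φ : OpenPartialHomeomorph E E, z₀ ∈ Φ.source ∧ Φ.source ⊆ O ∧
      ContDiffOn ℝ ∞ Φ Φ.source ∧ ContDiffOn ℝ ∞ Φ.symm Φ.target ∧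
      ∃ A : E →L[ℝ] ℂ, Function.Surjective A ∧ ∀ z ∈ Φ.source, σ z = A (Φ z) := by
  set A : E →L[ℝ] ℂ := fderiv ℝ σ z₀ with hA
  obtain ⟨B', hB'⟩ := A.toLinearMap.exists_rightInverse_of_surjective (LinearMap.range_eq_top.2 hs)
  set B : ℂ →L[ℝ] E := B'.toContinuousLinearMap with hBdef
  have hB : ∀ c, A (B c) = c := fun c => LinearMap.congr_fun hB' c
  -- Since AB = id, A∘Ψ = σ identically, and the derivative of Ψ at z₀ is the identity, so the
  -- inverse function theorem applies.
  set Ψ : E → E := fun z => z - B (A z) + B (σ z) with hΨ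
  have hΨO : ContDiffOn ℝ ∞ Ψ O :=
    (contDiffOn_id.sub (B.contDiff.comp A.contDiff).contDiffOn).add (B.contDiff.comp_contDiffOn hσ)
  have hΨat : ∀ z ∈ O, ContDiffAt ℝ ∞ Ψ z := fun z hz => hΨO.contDiffAt (hO.mem_nhds hz)
  have hdσ : HasFDerivAt σ A z₀ :=
    ((hσ.contDiffAt (hO.mem_nhds hz₀)).differentiableAt (by simp)).hasFDerivAt
  have hd : HasFDerivAt Ψ ((ContinuousLinearEquiv.refl ℝ E : E ≃L[ℝ] E) : E →L[ℝ] E) z₀ := by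
    have h1 := ((hasFDerivAt_id z₀).sub ((B.comp A).hasFDerivAt (x := z₀))).add
      (B.hasFDerivAt.comp z₀ hdσ)
    refine h1.congr_fderiv ?_
    ext v
    simp
  set Φ₀ := ContDiffAt.toOpenPartialHomeomorph Ψ (hΨat z₀ hz₀) hd (by simp) with hΦ₀
  have hΦ₀c : (Φ₀ : E → E) = Ψ := ContDiffAt.toOpenPartialHomeomorph_coe _ _ _
  have hcont : ContinuousOn (fderiv ℝ Ψ) O :=
    hΨO.continuousOn_fderiv_of_isOpen hO (by simp)
  -- Smoothness of the inverse is needed on the whole target, hence the restriction to points where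
  -- the derivative of Ψ is invertible; these form a neighbourhood of z₀.
  obtain ⟨O', hO'O, hO', hz₀'⟩ : ∃ O' ⊆ O, IsOpen O' ∧ z₀ ∈ O' ∧ ∀ z ∈ O', ∃ e : E ≃L[ℝ] E,
      (e : E →L[ℝ] E) = fderiv ℝ Ψ z := by
    have h1 : ∀ᶠ z in 𝓝 z₀, fderiv ℝ Ψ z ∈
        Set.range (ContinuousLinearEquiv.toContinuousLinearMap : (E ≃L[ℝ] E) → _) := by
      refine (hcont.continuousAt (hO.mem_nhds hz₀)).eventually_mem ?_
      rw [hd.fderiv]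
      exact ContinuousLinearEquiv.nhds _
    obtain ⟨t, ht, hto, hzt⟩ := eventually_nhds_iff.1 h1
    exact ⟨O ∩ t, Set.inter_subset_left, hO.inter hto, ⟨hz₀, hzt⟩, fun z hz => ht z hz.2⟩
  have hsrc : (Φ₀.restrOpen O' hO').source = Φ₀.source ∩ O' := rfl
  refine ⟨Φ₀.restrOpen O' hO', ⟨ContDiffAt.mem_toOpenPartialHomeomorph_source _ _ _, hz₀'.1⟩,
    fun z hz => hO'O hz.2, ?_, ?_, A, hs, fun z hz => ?_⟩
  · refine (hΨO.mono (s := O) fun z hz => hO'O hz.2).congr fun z hz => ?_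
    exact congrFun hΦ₀c z
  · intro z hz
    have hz2 : z ∈ Φ₀.target ∧ Φ₀.symm z ∈ O' := by
      have := (Φ₀.restrOpen O' hO').map_target hz
      exact ⟨by simpa using hz.1, this.2⟩
    obtain ⟨e, he⟩ := hz₀'.2 _ hz2.2
    refine (Φ₀.contDiffAt_symm (f₀' := e) hz2.1 ?_ ?_).contDiffWithinAt
    · rw [he, hΦ₀c]
      exact ((hΨat _ (hO'O hz2.2)).differentiableAt (by simp)).hasFDerivAt
    · rw [hΦ₀c]
      exact hΨat _ (hO'O hz2.2)
  · change σ z = A (Φ₀ z)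
    rw [hΦ₀c, hΨ]
    simp [hB]

variable {E : Type*} [NormedAddCommGroup E] [NormedSpace ℝ E]
  {M : Type*} [TopologicalSpace M] [ChartedSpace E M]

/-- A chart that is smooth in both directions. -/
structure IsSmoothChart (ψ : OpenPartialHomeomorph M E) : Prop where
  contMDiffOn : ContMDiffOn 𝓘(ℝ, E) 𝓘(ℝ, E) ∞ ψ ψ.source
  contMDiffOn_symm : ContMDiffOn 𝓘(ℝ, E) 𝓘(ℝ, E) ∞ ψ.symm ψ.target

namespace IsSmoothChart

variable {ψ : OpenPartialHomeomorph M E} (hψ : IsSmoothChart ψ)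
include hψ

theorem contMDiffAt {q : M} (hq : q ∈ ψ.source) : ContMDiffAt 𝓘(ℝ, E) 𝓘(ℝ, E) ∞ ψ q :=
  hψ.contMDiffOn.contMDiffAt (ψ.open_source.mem_nhds hq)

theorem contMDiffAt_symm {z : E} (hz : z ∈ ψ.target) :
    ContMDiffAt 𝓘(ℝ, E) 𝓘(ℝ, E) ∞ ψ.symm z :=
  hψ.contMDiffOn_symm.contMDiffAt (ψ.open_target.mem_nhds hz)

theorem mdifferentiable : ψ.MDifferentiable 𝓘(ℝ, E) 𝓘(ℝ, E) :=
  ⟨hψ.contMDiffOn.mdifferentiableOn (by simp), hψ.contMDiffOn_symm.mdifferentiableOn (by simp)⟩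

theorem dirDeriv_injective {q : M} (hq : q ∈ ψ.source) :
    Function.Injective (dirDeriv 𝓘(ℝ, E) ψ q) :=
  hψ.mdifferentiable.mfderiv_injective hq

theorem restrOpen {O : Set M} (hO : IsOpen O) : IsSmoothChart (ψ.restrOpen O hO) where
  contMDiffOn := hψ.contMDiffOn.mono fun _ hq => hq.1
  contMDiffOn_symm := hψ.contMDiffOn_symm.mono fun z hz => by simpa using hz.1

theorem exists_VField [CompleteSpace E] [IsManifold 𝓘(ℝ, E) ∞ M]
    {χ : SmoothFun 𝓘(ℝ, E) M}
    (hχ : tsupport χ ⊆ ψ.source) {T : E → E} (hT : ContDiff ℝ ∞ T) :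
    ∃ X : VField 𝓘(ℝ, E) M, (∀ q ∈ ψ.source, dirDeriv 𝓘(ℝ, E) ψ q (X q) = χ q • T (ψ q)) ∧
      ∀ q ∉ tsupport χ, X q = 0 := by
  have : IsManifold 𝓘(ℝ, E) 1 M := IsManifold.of_le (n := ∞) (by simp)
  have hinv : ∀ q ∈ ψ.source, (mfderiv 𝓘(ℝ, E) 𝓘(ℝ, E) ψ q).IsInvertible := fun q hq =>
    ⟨hψ.mdifferentiable.mfderiv hq, rfl⟩
  let V : ∀ z : E, TangentSpace 𝓘(ℝ, E) z := T
  have hV : ∀ z, ContMDiffAt 𝓘(ℝ, E) 𝓘(ℝ, E).tangent ∞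
      (fun z => (⟨z, V z⟩ : TangentBundle 𝓘(ℝ, E) E)) z := fun z =>
    contMDiffAt_vectorSpace_iff_contDiffAt.2 hT.contDiffAt
  have hpull : ContMDiffOn 𝓘(ℝ, E) 𝓘(ℝ, E).tangent ∞ (fun q =>
      (⟨q, VectorField.mpullback 𝓘(ℝ, E) 𝓘(ℝ, E) ψ V q⟩ : TangentBundle 𝓘(ℝ, E) M))
      ψ.source := fun q hq =>
    (ContMDiffAt.mpullback_vectorField_preimage (hV _) (hψ.contMDiffAt hq) (hinv q hq)
      (by simp)).contMDiffWithinAt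
  refine ⟨⟨fun q => χ q • VectorField.mpullback 𝓘(ℝ, E) 𝓘(ℝ, E) ψ V q,
    ContMDiffOn.smul_section_of_tsupport χ.contMDiff.contMDiffOn ψ.open_source hχ hpull⟩,
    fun q hq => ?_, fun q hq => ?_⟩
  · change dirDeriv 𝓘(ℝ, E) ψ q (χ q • VectorField.mpullback 𝓘(ℝ, E) 𝓘(ℝ, E) ψ V q) = _
    rw [dirDeriv_smul_vec]
    congr 1
    exact (hinv q hq).self_apply_inverse _
  · change χ q • VectorField.mpullback 𝓘(ℝ, E) 𝓘(ℝ, E) ψ V q = 0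
    rw [image_eq_zero_of_notMem_tsupport hq, zero_smul]

end IsSmoothChart

theorem isSmoothChart_chartAt [IsManifold 𝓘(ℝ, E) ∞ M] (p : M) : IsSmoothChart (chartAt E p) :=
  ⟨contMDiffOn_chart, contMDiffOn_chart_symm⟩

theorem exists_isSmoothChart_eq_linear [CompleteSpace E] [IsManifold 𝓘(ℝ, E) ∞ M] {O : Set M}
    (hO : IsOpen O) {p : M} (hp : p ∈ O) {σ : M → ℂ}
    (hσ : ∀ q ∈ O, ContMDiffAt 𝓘(ℝ, E) 𝓘(ℝ, ℂ) ∞ σ q)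
    (hs : Function.Surjective (mfderiv 𝓘(ℝ, E) 𝓘(ℝ, ℂ) σ p)) :
    ∃ ψ : OpenPartialHomeomorph M E, IsSmoothChart ψ ∧ p ∈ ψ.source ∧ ψ.source ⊆ O ∧
      ∃ A : E →L[ℝ] ℂ, Function.Surjective A ∧ ∀ q ∈ ψ.source, σ q = A (ψ q) := by
  set φ := (chartAt E p).restrOpen O hO with hφ
  have hφs : IsSmoothChart φ := (isSmoothChart_chartAt p).restrOpen hO
  have hpφ : p ∈ φ.source := ⟨mem_chart_source E p, hp⟩
  have hσφ : ContDiffOn ℝ ∞ (σ ∘ φ.symm) φ.target := by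
    intro z hz
    have h1 := (hσ _ (φ.map_target hz).2).comp z (hφs.contMDiffAt_symm hz)
    exact h1.contDiffAt.contDiffWithinAt
  have hsurj : Function.Surjective (fderiv ℝ (σ ∘ φ.symm) (φ p)) := by
    have hd := ((hσ p hp).mdifferentiableAt (by simp)).hasMFDerivAt
    have hd' := (hφs.mdifferentiable.symm.mdifferentiableAt (φ.map_source hpφ)).hasMFDerivAt
    rw [← φ.left_inv hpφ] at hd
    have hc := (hd.comp (φ p) hd').mfderiv
    rw [mfderiv_eq_fderiv] at hc
    rw [hc]
    have h2 : Function.Surjective (mfderiv 𝓘(ℝ, E) 𝓘(ℝ, ℂ) σ (φ.symm (φ p))) := by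
      rw [φ.left_inv hpφ]; exact hs
    exact h2.comp (hφs.mdifferentiable.symm.mfderiv_surjective (φ.map_source hpφ))
  obtain ⟨Φ, hpΦ, hΦO, hΦ, hΦs, A, hA, hAσ⟩ := exists_openPartialHomeomorph_eq_linear φ.open_target
    (φ.map_source hpφ) hσφ hsurj
  refine ⟨φ.trans Φ, ⟨?_, ?_⟩, ?_, ?_, A, hA, ?_⟩
  · intro q hq
    rw [OpenPartialHomeomorph.trans_source] at hq
    exact ((hΦ.contDiffAt (Φ.open_source.mem_nhds hq.2)).contMDiffAt.comp q
      (hφs.contMDiffAt hq.1)).contMDiffWithinAt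
  · intro z hz
    rw [OpenPartialHomeomorph.trans_target] at hz
    exact ((hφs.contMDiffAt_symm hz.2).comp z
      (hΦs.contDiffAt (Φ.open_target.mem_nhds hz.1)).contMDiffAt).contMDiffWithinAt
  · rw [OpenPartialHomeomorph.trans_source]
    exact ⟨hpφ, hpΦ⟩
  · rw [OpenPartialHomeomorph.trans_source]
    exact fun q hq => hq.1.2
  · intro q hq
    rw [OpenPartialHomeomorph.trans_source] at hq
    have := hAσ _ hq.2
    rwa [Function.comp_apply, φ.left_inv hq.1] at this

end Straightening

/-! ### Elliptic fields and their local frames -/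

set_option linter.unusedSectionVars false

namespace ComplexDivisor

variable {E : Type} [NormedAddCommGroup E] [NormedSpace ℝ E] [FiniteDimensional ℝ E]
  {M : Type*} [TopologicalSpace M] [ChartedSpace E M]
  [IsManifold 𝓘(ℝ, E) ∞ M] [T2Space M]
  {U : M → Type*} [TopologicalSpace (TotalSpace ℂ U)] [∀ p, AddCommGroup (U p)]
  [∀ p, Module ℂ (U p)] [∀ p, TopologicalSpace (U p)] [FiberBundle ℂ U]
  [VectorBundle ℂ ℂ U] [VectorBundle ℝ ℂ U] [ContMDiffVectorBundle ∞ ℂ U 𝓘(ℝ, E)]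
  (D : ComplexDivisor 𝓘(ℝ, E) U)

theorem exists_chart_localRep_eq_linear {p : M} (hp : p ∈ D.locus) :
    ∃ ψ : OpenPartialHomeomorph M E, IsSmoothChart ψ ∧ p ∈ ψ.source ∧
      ψ.source ⊆ (trivializationAt ℂ U p).baseSet ∧
      ∃ A : E →L[ℝ] ℂ, Function.Surjective A ∧ ∀ q ∈ ψ.source, D.localRep p q = A (ψ q) :=
  exists_isSmoothChart_eq_linear (trivializationAt ℂ U p).open_baseSet
    (FiberBundle.mem_baseSet_trivializationAt' p) (fun _ hq => D.contMDiffAt_localRep hq)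
    (D.transverse p hp)

/-- Applying X to a cutoff of |σ|² gives 2 Re(σ̄ X(σ)) = h|σ|² near p. Then X(σ) - (h/2)σ pairs with
σ to zero real part, so it equals ibσ by division in straightened coordinates, and c = h/2 + ib. -/
theorem exists_dirDeriv_localRep_eq_mul {X : VField 𝓘(ℝ, E) M} (hX : X ∈ D.ellipticFields)
    {p : M} (hp : p ∈ D.locus) :
    ∃ c : M → ℂ, (∀ᶠ q in 𝓝 p, ContMDiffAt 𝓘(ℝ, E) 𝓘(ℝ, ℂ) ∞ c q) ∧
      ∀ᶠ q in 𝓝 p, dirDeriv 𝓘(ℝ, E) (D.localRep p) q (X q) = c q * D.localRep p q := by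
  set W := (trivializationAt ℂ U p).baseSet with hW
  have hpW : p ∈ W := FiberBundle.mem_baseSet_trivializationAt' p
  obtain ⟨χ, hχ1, hχ⟩ := exists_smoothFun_eventuallyEq_one (I := 𝓘(ℝ, E))
    ((trivializationAt ℂ U p).open_baseSet.mem_nhds hpW)
  let ρ : SmoothFun 𝓘(ℝ, E) M := ⟨fun q => χ q • Complex.normSq (D.localRep p q),
    contMDiff_smul_of_tsupport χ fun q hq => contMDiffAt_normSq (D.contMDiffAt_localRep (hχ hq))⟩
  have hρ : ρ ∈ D.ellipticIdeal := D.mem_ellipticIdeal_of_eq_mul hχ fun q => rfl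
  obtain ⟨g, hg, hgX⟩ := hX ρ hρ
  obtain ⟨h, hh⟩ := D.exists_eq_mul_of_mem_ellipticIdeal hχ hg
  set O := {q | ∀ᶠ x in 𝓝 q, χ x = 1} with hOdef
  have hO : IsOpen O := isOpen_setOfPred_eventually_nhds
  have hOW : O ⊆ W := fun q hq => hχ (subset_tsupport _ (by
    have : χ q = 1 := hq.self_of_nhds
    simp [this]))
  set ξ : M → ℂ := fun q => dirDeriv 𝓘(ℝ, E) (D.localRep p) q (X q) with hξ
  have hξs : ∀ q ∈ W, ContMDiffAt 𝓘(ℝ, E) 𝓘(ℝ, ℂ) ∞ ξ q := fun q hq =>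
    X.contMDiffAt_dirDeriv (D.contMDiffAt_localRep hq)
  have key : ∀ q ∈ O, (conj (D.localRep p q) * (ξ q - (h q / 2 : ℝ) * D.localRep p q)).re = 0 := by
    intro q hq
    have h1 : (ρ : M → ℝ) =ᶠ[𝓝 q] fun x => Complex.normSq (D.localRep p x) := by
      filter_upwards [hq] with x hx
      change χ x • Complex.normSq (D.localRep p x) = _
      rw [hx, one_smul]
    have hd : MDifferentiableAt 𝓘(ℝ, E) 𝓘(ℝ, ℂ) (D.localRep p) q :=
      (D.contMDiffAt_localRep (hOW hq)).mdifferentiableAt (by simp)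
    have h2 : g q = 2 * (conj (D.localRep p q) * ξ q).re :=
      (hgX q).trans ((dirDeriv_congr h1 (X q)).trans (dirDeriv_normSq hd (X q)))
    have h3 := hh q hq.self_of_nhds
    rw [h2] at h3
    simp only [Complex.mul_re, Complex.sub_re, Complex.sub_im, Complex.conj_re, Complex.conj_im,
      Complex.normSq_apply, Complex.ofReal_re, Complex.ofReal_im, Complex.mul_im] at h3 ⊢
    linarith
  obtain ⟨ψ, hψ, hpψ, hψW, A, hA, hAψ⟩ := D.exists_chart_localRep_eq_linear hp
  set u := ψ.target ∩ ψ.symm ⁻¹' O with hu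
  have huo : IsOpen u := ψ.isOpen_inter_preimage_symm hO
  have hpu : ψ p ∈ u := ⟨ψ.map_source hpψ, by
    change ψ.symm (ψ p) ∈ O
    rw [ψ.left_inv hpψ]; exact hχ1⟩
  have hζ : ContDiffOn ℝ ∞ (fun z => ξ (ψ.symm z) - (h (ψ.symm z) / 2 : ℝ) * A z) u := by
    intro z hz
    have hs := hψ.contMDiffAt_symm hz.1
    have h1 : ContDiffAt ℝ ∞ (fun z => ξ (ψ.symm z)) z :=
      ((hξs _ (hOW hz.2)).comp z hs).contDiffAt
    have h2 : ContDiffAt ℝ ∞ (fun z => h (ψ.symm z)) z :=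
      (h.contMDiff.contMDiffAt.comp z hs).contDiffAt
    exact (h1.sub ((Complex.ofRealCLM.contDiff.contDiffAt.comp z (h2.div_const 2)).mul
      A.contDiff.contDiffAt)).contDiffWithinAt
  have hA0 : A (ψ p) = 0 := by
    rw [← hAψ p hpψ]
    exact (D.localRep_eq_zero_iff hpW).2 hp
  obtain ⟨v, hv, hpv, b, hb, hbζ⟩ := exists_contDiffOn_eq_I_mul A hA hA0 (huo.mem_nhds hpu) hζ
    (fun z hz => by
      have := key _ hz.2
      rwa [hAψ _ (ψ.map_target hz.1), ψ.right_inv hz.1] at this)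
  have hev : ∀ᶠ q in 𝓝 p, q ∈ ψ.source ∧ ψ q ∈ v :=
    (ψ.open_source.eventually_mem hpψ).and ((ψ.continuousAt hpψ).eventually_mem (hv.mem_nhds hpv))
  refine ⟨fun q => (h q / 2 : ℝ) + Complex.I * b (ψ q), ?_, ?_⟩
  · filter_upwards [hev] with q hq
    have h1 : ContMDiffAt 𝓘(ℝ, E) 𝓘(ℝ, ℝ) ∞ (fun q => b (ψ q)) q :=
      (hb.contDiffAt (hv.mem_nhds hq.2)).contMDiffAt.comp q (hψ.contMDiffAt hq.1)
    have h2 : ContDiff ℝ ∞ (fun r : ℝ × ℝ => ((r.1 / 2 : ℝ) : ℂ) + Complex.I * r.2) :=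
      (Complex.ofRealCLM.contDiff.comp (contDiff_fst.div_const 2)).add
        (contDiff_const.mul (Complex.ofRealCLM.contDiff.comp contDiff_snd))
    exact h2.contMDiff.contMDiffAt.comp q (h.contMDiff.contMDiffAt.prodMk_space h1)
  · filter_upwards [hev] with q hq
    have := hbζ (ψ q) hq.2
    rw [ψ.left_inv hq.1, ← hAψ q hq.1] at this
    change ξ q = _
    rw [add_mul, ← this]
    ring

/-- The mechanism common to points on and off D. The model fibre is G, `T z` plays the anchor in the
chart, and κ recovers the element of G from the quotient c and the chart expression of w. The frame
comes from a basis of G. -/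
theorem exists_frame_of_chart {p : M} {ψ : OpenPartialHomeomorph M E} (hψ : IsSmoothChart ψ)
    (hp : p ∈ ψ.source) (hψW : ψ.source ⊆ (trivializationAt ℂ U p).baseSet)
    {G : Type} [AddCommGroup G] [Module ℝ G] [FiniteDimensional ℝ G] (T : E → G →ₗ[ℝ] E)
    (κ : ℂ × E →ₗ[ℝ] G) (hT : ∀ g, ContDiff ℝ ∞ fun z => T z g)
    (hinj : ∀ q ∈ ψ.source, q ∉ D.locus → Function.Injective (T (ψ q)))
    (hspan : ∀ q ∈ ψ.source, ∀ c w,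
      dirDeriv 𝓘(ℝ, E) (D.localRep p) q w = c * D.localRep p q →
      T (ψ q) (κ (c, dirDeriv 𝓘(ℝ, E) ψ q w)) = dirDeriv 𝓘(ℝ, E) ψ q w)
    (hell : ∀ g, ∃ C : M → ℂ, (∀ q ∈ ψ.source, ContMDiffAt 𝓘(ℝ, E) 𝓘(ℝ, ℂ) ∞ C q) ∧
      ∀ q ∈ ψ.source, ∀ (a : ℝ) v, dirDeriv 𝓘(ℝ, E) ψ q v = a • T (ψ q) g →
        dirDeriv 𝓘(ℝ, E) (D.localRep p) q v = (a • C q) * D.localRep p q) :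
    ∃ (r : ℕ) (e : Fin r → D.ellipticFields) (θ : M → E) (Λ : ℂ × E →ₗ[ℝ] (Fin r → ℝ)),
      (∀ᶠ q in 𝓝 p, ContMDiffAt 𝓘(ℝ, E) 𝓘(ℝ, E) ∞ θ q) ∧
      (∀ᶠ q in 𝓝 p, q ∉ D.locus →
        LinearIndependent ℝ fun i => ((e i : VField 𝓘(ℝ, E) M) q : TangentSpace 𝓘(ℝ, E) q)) ∧
      ∀ᶠ q in 𝓝 p, ∀ c w, dirDeriv 𝓘(ℝ, E) (D.localRep p) q w = c * D.localRep p q →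
        w = ∑ i, Λ (c, dirDeriv 𝓘(ℝ, E) θ q w) i • (e i : VField 𝓘(ℝ, E) M) q := by
  obtain ⟨χ', hχ'1, hχ'⟩ := exists_smoothFun_eventuallyEq_one (I := 𝓘(ℝ, E))
    ((trivializationAt ℂ U p).open_baseSet.mem_nhds (hψW hp))
  -- Nested cutoffs: χ' is 1 near every point of the support of χ, as `mem_ellipticFields_of_eq_mul`
  -- requires with K that support.
  obtain ⟨χ, hχ1, hχ⟩ := exists_smoothFun_eventuallyEq_one (I := 𝓘(ℝ, E))
    (Filter.inter_mem (ψ.open_source.mem_nhds hp) (eventually_eventually_nhds.2 hχ'1))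
  have hχψ : tsupport χ ⊆ ψ.source := fun q hq => (hχ hq).1
  let b := Module.finBasis ℝ G
  have hfield : ∀ g, ∃ X : D.ellipticFields, ∀ q ∈ ψ.source,
      dirDeriv 𝓘(ℝ, E) ψ q ((X : VField 𝓘(ℝ, E) M) q) = χ q • T (ψ q) g := by
    intro g
    obtain ⟨X, hX, hX0⟩ := hψ.exists_VField hχψ (hT g)
    obtain ⟨C, hC, hCX⟩ := hell g
    refine ⟨⟨X, D.mem_ellipticFields_of_eq_mul hχ' (isClosed_tsupport χ)
      (fun q hq => (hχ hq).2) hX0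
      (contMDiff_smul_of_tsupport χ fun q hq => hC q (hχψ hq)) (fun q hq => ?_)
      fun q hq => ?_⟩, hX⟩
    · rw [image_eq_zero_of_notMem_tsupport hq, zero_smul]
    · exact hCX q (hχψ hq) _ _ (hX q (hχψ hq))
  choose e he using hfield
  have hev : ∀ᶠ q in 𝓝 p, q ∈ ψ.source ∧ χ q = 1 :=
    (ψ.open_source.eventually_mem hp).and hχ1
  have hsum : ∀ q ∈ ψ.source, χ q = 1 → ∀ a : Fin (Module.finrank ℝ G) → ℝ,
      dirDeriv 𝓘(ℝ, E) ψ q (∑ i, a i • (e (b i) : VField 𝓘(ℝ, E) M) q) =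
        T (ψ q) (b.equivFun.symm a) := by
    intro q hq hq1 a
    rw [dirDeriv_sum_vec, Module.Basis.equivFun_symm_apply, map_sum]
    refine Finset.sum_congr rfl fun i _ => ?_
    rw [dirDeriv_smul_vec, he _ q hq, hq1, one_smul, map_smul]
  refine ⟨_, fun i => e (b i), ψ, b.equivFun.toLinearMap ∘ₗ κ, ?_, ?_, ?_⟩
  · filter_upwards [hev] with q hq using hψ.contMDiffAt hq.1
  · filter_upwards [hev] with q hq hqD
    rw [Fintype.linearIndependent_iff]
    intro a ha
    have h1 := hsum q hq.1 hq.2 a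
    have h2 : T (ψ q) (b.equivFun.symm a) = 0 := by
      rw [← h1]
      exact (congrArg (dirDeriv 𝓘(ℝ, E) ψ q) ha).trans (dirDeriv_zero_vec _ _)
    have h3 := hinj q hq.1 hqD (h2.trans (map_zero _).symm)
    rw [LinearEquiv.map_eq_zero_iff] at h3
    exact fun i => congrFun h3 i
  · filter_upwards [hev] with q hq c w hw
    refine hψ.dirDeriv_injective hq.1 ?_
    refine Eq.trans ?_ (hsum q hq.1 hq.2 _).symm
    change _ = T (ψ q) (b.equivFun.symm (b.equivFun _))
    rw [LinearEquiv.symm_apply_apply, hspan q hq.1 c w hw]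

/-- Local frames of the elliptic tangent bundle: near any point there are elliptic fields, linearly
independent off the divisor, in which a tangent vector `w` is expanded with coefficients depending
smoothly on `w` and on the quotient of the derivative of the divisor along `w` by the divisor. -/
theorem exists_frame (p : M) :
    ∃ (r : ℕ) (e : Fin r → D.ellipticFields) (θ : M → E) (Λ : ℂ × E →ₗ[ℝ] (Fin r → ℝ)),
      (∀ᶠ q in 𝓝 p, ContMDiffAt 𝓘(ℝ, E) 𝓘(ℝ, E) ∞ θ q) ∧
      (∀ᶠ q in 𝓝 p, q ∉ D.locus →
        LinearIndependent ℝ fun i => ((e i : VField 𝓘(ℝ, E) M) q : TangentSpace 𝓘(ℝ, E) q)) ∧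
      ∀ᶠ q in 𝓝 p, ∀ c w, dirDeriv 𝓘(ℝ, E) (D.localRep p) q w = c * D.localRep p q →
        w = ∑ i, Λ (c, dirDeriv 𝓘(ℝ, E) θ q w) i • (e i : VField 𝓘(ℝ, E) M) q := by
  by_cases hp : p ∈ D.locus
  · obtain ⟨ψ, hψ, hpψ, hψW, A, hA, hAψ⟩ := D.exists_chart_localRep_eq_linear hp
    obtain ⟨B', hB'⟩ := A.toLinearMap.exists_rightInverse_of_surjective
      (LinearMap.range_eq_top.2 hA)
    set B : ℂ →L[ℝ] E := B'.toContinuousLinearMap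
    have hB : ∀ c, A (B c) = c := fun c => LinearMap.congr_fun hB' c
    have hσ : ∀ q ∈ ψ.source, ∀ v, dirDeriv 𝓘(ℝ, E) (D.localRep p) q v =
        A (dirDeriv 𝓘(ℝ, E) ψ q v) := fun q hq v => by
      rw [← dirDeriv_clm_comp A ((hψ.contMDiffAt hq).mdifferentiableAt (by simp))]
      refine dirDeriv_congr ?_ v
      filter_upwards [ψ.open_source.mem_nhds hq] with x hx using hAψ x hx
    let K := LinearMap.ker A.toLinearMap
    -- The field B(cA) multiplies σ = A by c: c = 1 is the radial field and c = i the rotation in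
    -- the normal plane. The fields in ker A annihilate σ.
    let T : E → (ℂ × K) →ₗ[ℝ] E := fun z =>
      { toFun := fun g => B (g.1 * A z) + g.2
        map_add' := fun g g' => by
          simp only [Prod.fst_add, Prod.snd_add, add_mul, map_add, Submodule.coe_add]; abel
        map_smul' := fun a g => by
          simp only [Prod.smul_fst, Prod.smul_snd, smul_mul_assoc, map_smul, Submodule.coe_smul,
            smul_add, RingHom.id_apply] }
    let κ : ℂ × E →ₗ[ℝ] ℂ × K := LinearMap.prod (LinearMap.fst ℝ ℂ E)
      (((LinearMap.id - B'.comp A.toLinearMap).codRestrict K fun x => by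
        change A (x - B (A x)) = 0
        rw [map_sub, hB, sub_self]).comp (LinearMap.snd ℝ ℂ E))
    have hTκ : ∀ z c x, T z (κ (c, x)) = B (c * A z) + (x - B (A x)) := fun _ _ _ => rfl
    have hTA : ∀ z g, A (T z g) = g.1 * A z := fun z g => by
      change A (B (g.1 * A z) + g.2) = _
      have : A (g.2 : E) = 0 := g.2.2
      rw [map_add, hB, this, add_zero]
    refine D.exists_frame_of_chart hψ hpψ hψW T κ (fun g => ?_) (fun q hq hqD => ?_)
      (fun q hq c w hw => ?_) fun g => ⟨fun _ => g.1, fun _ _ => contMDiffAt_const,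
        fun q hq a v hv => ?_⟩
    · exact (B.contDiff.comp (contDiff_const.mul A.contDiff)).add contDiff_const
    · rw [← LinearMap.ker_eq_bot, LinearMap.ker_eq_bot']
      intro g hg
      have h1 := hTA (ψ q) g
      have hne : A (ψ q) ≠ 0 := by
        rw [← hAψ q hq]
        exact fun h => hqD ((D.localRep_eq_zero_iff (hψW hq)).1 h)
      rw [hg, map_zero, eq_comm, mul_eq_zero, or_iff_left hne] at h1
      have h2 : B (g.1 * A (ψ q)) + (g.2 : E) = 0 := hg
      rw [h1, zero_mul, map_zero, zero_add] at h2
      exact Prod.ext h1 (Subtype.ext h2)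
    · rw [hTκ, ← hσ q hq, hw, hAψ q hq]
      abel
    · rw [hσ q hq, hv, map_smul, hTA, hAψ q hq, smul_mul_assoc]
  -- Off D every field is locally elliptic, with quotient dσ/σ, so a coordinate frame of TM works
  -- and κ ignores c.
  · have hpW : p ∈ (trivializationAt ℂ U p).baseSet :=
      FiberBundle.mem_baseSet_trivializationAt' p
    have hne : D.localRep p p ≠ 0 := fun h => hp ((D.localRep_eq_zero_iff hpW).1 h)
    obtain ⟨O, hO, hOo, hpO⟩ := eventually_nhds_iff.1
      (((trivializationAt ℂ U p).open_baseSet.eventually_mem hpW).and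
        ((D.contMDiffAt_localRep hpW).continuousAt.eventually_ne hne))
    have hψ := (isSmoothChart_chartAt (E := E) p).restrOpen hOo
    set ψ := (chartAt E p).restrOpen O hOo
    have hψO : ψ.source ⊆ O := fun q hq => hq.2
    refine D.exists_frame_of_chart hψ ⟨mem_chart_source E p, hpO⟩ (fun q hq => (hO q (hψO hq)).1)
      (fun _ => LinearMap.id) (LinearMap.snd ℝ ℂ E) (fun g => contDiff_const)
      (fun _ _ _ => Function.injective_id) (fun q hq c w hw => rfl) fun g => ?_
    have hsymm : ∀ q ∈ ψ.source, ∀ v, dirDeriv 𝓘(ℝ, E) (D.localRep p) q v =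
        fderiv ℝ (fun z => D.localRep p (ψ.symm z)) (ψ q) (dirDeriv 𝓘(ℝ, E) ψ q v) := by
      intro q hq v
      have hd : DifferentiableAt ℝ (fun z => D.localRep p (ψ.symm z)) (ψ q) := by
        have h1 := D.contMDiffAt_localRep (p := p) (hO q (hψO hq)).1
        rw [← ψ.left_inv hq] at h1
        exact (h1.comp (ψ q)
          (hψ.contMDiffAt_symm (ψ.map_source hq))).contDiffAt.differentiableAt (by simp)
      have h2 := dirDeriv_comp (I := 𝓘(ℝ, E)) (I' := 𝓘(ℝ, E)) (j := ψ)
        (f := fun z => D.localRep p (ψ.symm z)) (n := q) hd.mdifferentiableAt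
        ((hψ.contMDiffAt hq).mdifferentiableAt (by simp)) v
      have h3 : mfderiv 𝓘(ℝ, E) 𝓘(ℝ, ℂ) (fun z => D.localRep p (ψ.symm z)) (ψ q) =
        fderiv ℝ (fun z => D.localRep p (ψ.symm z)) (ψ q) := mfderiv_eq_fderiv
      refine Eq.trans (dirDeriv_congr ?_ v) (h2.trans
        (congrArg (fun L : E →L[ℝ] ℂ => L (dirDeriv 𝓘(ℝ, E) ψ q v)) h3))
      filter_upwards [ψ.open_source.mem_nhds hq] with x hx
      rw [ψ.left_inv hx]
    refine ⟨fun q => fderiv ℝ (fun z => D.localRep p (ψ.symm z)) (ψ q) g / D.localRep p q,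
      fun q hq => ?_, fun q hq a v hv => ?_⟩
    · have h1 : ContDiffOn ℝ ∞ (fun z => D.localRep p (ψ.symm z)) ψ.target := fun z hz =>
        ((D.contMDiffAt_localRep (hO _ (hψO (ψ.map_target hz))).1).comp z
          (hψ.contMDiffAt_symm hz)).contDiffAt.contDiffWithinAt
      have h2 : ContDiffAt ℝ ∞
          (fun z => fderiv ℝ (fun z => D.localRep p (ψ.symm z)) z g) (ψ q) :=
        ((h1.contDiffAt (ψ.open_target.mem_nhds (ψ.map_source hq))).fderiv_right
          (m := ∞) (by simp)).clm_apply contDiffAt_const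
      have h3 : ContMDiffAt 𝓘(ℝ, E) 𝓘(ℝ, ℂ) ∞
          (fun q => fderiv ℝ (fun z => D.localRep p (ψ.symm z)) (ψ q) g) q :=
        h2.contMDiffAt.comp q (hψ.contMDiffAt hq)
      have h4 := D.contMDiffAt_localRep (p := p) (hO q (hψO hq)).1
      exact contMDiffAt_complex_div h3 h4 (hO q (hψO hq)).2
    · rw [hsymm q hq, hv, map_smul, smul_mul_assoc, div_mul_cancel₀ _ (hO q (hψO hq)).2]
      rfl

end ComplexDivisor

/-! ### Boundary coordinates and logarithmic fields -/

section BoundaryCoordinate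

variable {k : ℕ} [NeZero k] {Y : Type*} [TopologicalSpace Y] [ChartedSpace (EuclideanHalfSpace k) Y]

/-- The coordinate defining the boundary in the chart at `y₀`. -/
def boundaryCoord (k : ℕ) [NeZero k] {Y : Type*} [TopologicalSpace Y]
    [ChartedSpace (EuclideanHalfSpace k) Y] (y₀ y : Y) : ℝ :=
  (extChartAt (𝓡∂ k) y₀ y : EuclideanSpace ℝ (Fin k)) 0

theorem boundaryTangent_eq_top_iff {y : Y} :
    boundaryTangent (k := k) y = ⊤ ↔ ∀ v, dirDeriv (𝓡∂ k) (boundaryCoord k y) y v = 0 := by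
  rw [boundaryTangent, Submodule.eq_top_iff']
  rfl

variable [IsManifold (𝓡∂ k) ∞ Y]

theorem contMDiffAt_boundaryCoord {y₀ y : Y} (hy : y ∈ (chartAt (EuclideanHalfSpace k) y₀).source) :
    ContMDiffAt (𝓡∂ k) 𝓘(ℝ, ℝ) ∞ (boundaryCoord k y₀) y :=
  (EuclideanSpace.proj (𝕜 := ℝ) (0 : Fin k)).contDiff.contMDiff.contMDiffAt.comp y
    (contMDiffAt_extChartAt' hy)

theorem boundaryTangent_ne_top (y : Y) : boundaryTangent (k := k) y ≠ ⊤ := by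
  rw [Ne, boundaryTangent_eq_top_iff]
  intro h
  have : IsManifold (𝓡∂ k) 1 Y := IsManifold.of_le (n := ∞) (by simp)
  have hinv := isInvertible_mfderiv_extChartAt (I := 𝓡∂ k) (mem_extChartAt_source (I := 𝓡∂ k) y)
  have hd : MDifferentiableAt (𝓡∂ k) 𝓘(ℝ, EuclideanSpace ℝ (Fin k)) (extChartAt (𝓡∂ k) y) y :=
    (contMDiffAt_extChartAt (n := 1)).mdifferentiableAt (by simp)
  have h1 := h ((mfderiv (𝓡∂ k) 𝓘(ℝ, EuclideanSpace ℝ (Fin k)) (extChartAt (𝓡∂ k) y) y).inverse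
    (EuclideanSpace.single (0 : Fin k) (1 : ℝ)))
  have h2 := dirDeriv_clm_comp (I := 𝓡∂ k) (EuclideanSpace.proj (𝕜 := ℝ) (0 : Fin k)) hd
    ((mfderiv (𝓡∂ k) 𝓘(ℝ, EuclideanSpace ℝ (Fin k)) (extChartAt (𝓡∂ k) y) y).inverse
      (EuclideanSpace.single (0 : Fin k) (1 : ℝ)))
  have h3 : dirDeriv (𝓡∂ k) (extChartAt (𝓡∂ k) y) y
      ((mfderiv (𝓡∂ k) 𝓘(ℝ, EuclideanSpace ℝ (Fin k)) (extChartAt (𝓡∂ k) y) y).inverse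
        (EuclideanSpace.single (0 : Fin k) (1 : ℝ))) = EuclideanSpace.single (0 : Fin k) (1 : ℝ) :=
    hinv.self_apply_inverse _
  rw [h3] at h2
  have h4 := h1.symm.trans h2
  simp at h4

/-- Being interior may be tested in any chart of the atlas, here the one at y₀ rather than the one
at y. -/
theorem mem_boundary_iff_boundaryCoord_eq_zero {y₀ y : Y}
    (hy : y ∈ (chartAt (EuclideanHalfSpace k) y₀).source) :
    y ∈ (𝓡∂ k).boundary Y ↔ boundaryCoord k y₀ y = 0 := by
  have h1 : (𝓡∂ k).IsInteriorPoint y ↔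
      extChartAt (𝓡∂ k) y₀ y ∈ interior (Set.range (𝓡∂ k)) := by
    rw [ModelWithCorners.isInteriorPoint_iff_of_mem_atlas (n := ∞) (by simp)
      (chart_mem_atlas (EuclideanHalfSpace k) y₀) hy]
    exact ⟨fun h => OpenPartialHomeomorph.interior_extend_target_subset_interior_range _ h,
      fun h => (chartAt _ y₀).mem_interior_extend_target ((chartAt _ y₀).map_source hy) h⟩
  have h0 : 0 ≤ boundaryCoord k y₀ y := by
    have : extChartAt (𝓡∂ k) y₀ y ∈ Set.range (𝓡∂ k) := Set.mem_range_self _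
    rw [range_modelWithCornersEuclideanHalfSpace] at this
    exact this
  rw [interior_range_modelWithCornersEuclideanHalfSpace] at h1
  change (𝓡∂ k).IsBoundaryPoint y ↔ _
  rw [ModelWithCorners.isBoundaryPoint_iff_not_isInteriorPoint, h1]
  change ¬ (0 < boundaryCoord k y₀ y) ↔ _
  rw [not_lt]
  exact ⟨fun h => le_antisymm h h0, fun h => h.le⟩

theorem dense_compl_boundary : Dense ((𝓡∂ k).boundary Y)ᶜ := by
  intro y₀
  rw [mem_closure_iff_nhds]
  intro O hO
  rw [← map_extChartAt_symm_nhdsWithin_range (I := 𝓡∂ k) y₀, Filter.mem_map] at hO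
  have h1 := Filter.inter_mem hO (extChartAt_target_mem_nhdsWithin (I := 𝓡∂ k) y₀)
  obtain ⟨u, hu, huO⟩ := mem_nhdsWithin_iff_exists_mem_nhds_inter.1 h1
  have h2 : extChartAt (𝓡∂ k) y₀ y₀ ∈ closure (interior (Set.range (𝓡∂ k))) :=
    (𝓡∂ k).range_subset_closure_interior (Set.mem_range_self _)
  obtain ⟨z, hzu, hz⟩ := mem_closure_iff_nhds.1 h2 u hu
  obtain ⟨hzO, hzt⟩ := huO ⟨hzu, interior_subset hz⟩
  refine ⟨(extChartAt (𝓡∂ k) y₀).symm z, hzO, fun hb => ?_⟩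
  have hs : (extChartAt (𝓡∂ k) y₀).symm z ∈ (chartAt (EuclideanHalfSpace k) y₀).source := by
    rw [← extChartAt_source (𝓡∂ k)]
    exact (extChartAt (𝓡∂ k) y₀).map_target hzt
  rw [mem_boundary_iff_boundaryCoord_eq_zero hs, boundaryCoord,
    (extChartAt (𝓡∂ k) y₀).right_inv hzt] at hb
  rw [interior_range_modelWithCornersEuclideanHalfSpace] at hz
  exact absurd hb (ne_of_gt hz)

/-- Hadamard's lemma at a boundary point. -/
theorem exists_eq_boundaryCoord_smul {F : Type} [NormedAddCommGroup F] [NormedSpace ℝ F]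
    [CompleteSpace F] {y₀ : Y} (hy₀ : y₀ ∈ (𝓡∂ k).boundary Y) {f : Y → F}
    (hf : ∀ᶠ y in 𝓝 y₀, ContMDiffAt (𝓡∂ k) 𝓘(ℝ, F) ∞ f y)
    (hf0 : ∀ᶠ y in 𝓝 y₀, y ∈ (𝓡∂ k).boundary Y → f y = 0) :
    ∃ g : Y → F, (∀ᶠ y in 𝓝 y₀, ContMDiffAt (𝓡∂ k) 𝓘(ℝ, F) ∞ g y) ∧
      ∀ᶠ y in 𝓝 y₀, f y = boundaryCoord k y₀ y • g y := by
  set φ := extChartAt (𝓡∂ k) y₀ with hφ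
  have hO := hf.and hf0
  rw [← map_extChartAt_symm_nhdsWithin_range (I := 𝓡∂ k) y₀, Filter.eventually_map] at hO
  have h1 := Filter.inter_mem hO (extChartAt_target_mem_nhdsWithin (I := 𝓡∂ k) y₀)
  obtain ⟨u, hu, huO⟩ := mem_nhdsWithin_iff_exists_mem_nhds_inter.1 h1
  have hsrc : ∀ z ∈ φ.target, φ.symm z ∈ (chartAt (EuclideanHalfSpace k) y₀).source := fun z hz => by
    rw [← extChartAt_source (𝓡∂ k)]
    exact φ.map_target hz
  have hC : Set.range (𝓡∂ k) = {z : EuclideanSpace ℝ (Fin k) | 0 ≤ z 0} :=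
    range_modelWithCornersEuclideanHalfSpace k
  obtain ⟨v, hv, hv0, g, hg, hgf⟩ := exists_contDiffOn_eq_smul (C := Set.range (𝓡∂ k))
    (𝓡∂ k).convex_range
    ⟨EuclideanSpace.single (0 : Fin k) (1 : ℝ), by
      rw [interior_range_modelWithCornersEuclideanHalfSpace]
      simp⟩
    (EuclideanSpace.proj (𝕜 := ℝ) (0 : Fin k)) (e := EuclideanSpace.single (0 : Fin k) (1 : ℝ))
    (by simp)
    (fun z hz s hs => by
      rw [hC] at hz ⊢
      have hz' : 0 ≤ z 0 := hz
      have : 0 ≤ s * z 0 := mul_nonneg hs.1 hz'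
      have h2 : z 0 - (1 - s) * z 0 = s * z 0 := by ring
      simpa [h2] using this)
    (z₀ := φ y₀)
    ((mem_boundary_iff_boundaryCoord_eq_zero (mem_chart_source _ y₀)).1 hy₀) hu
    (f := f ∘ φ.symm)
    (fun z hz => by
      have hz' := huO ⟨hz.2, hz.1⟩
      have h3 := (hz'.1.1.comp_contMDiffWithinAt z
        (contMDiffOn_extChartAt_symm (I := 𝓡∂ k) (n := ∞) y₀ z hz'.2))
      refine ContDiffWithinAt.mono ?_ (fun x hx => (huO ⟨hx.2, hx.1⟩).2)
      exact h3.contDiffWithinAt)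
    (fun z hz hz0 => by
      have hz' := huO ⟨hz.2, hz.1⟩
      refine hz'.1.2 ((mem_boundary_iff_boundaryCoord_eq_zero (hsrc z hz'.2)).2 ?_)
      rw [boundaryCoord, φ.right_inv hz'.2]
      exact hz0)
  have hev : ∀ᶠ y in 𝓝 y₀, y ∈ (chartAt (EuclideanHalfSpace k) y₀).source ∧ φ y ∈ v :=
    ((chartAt (EuclideanHalfSpace k) y₀).open_source.eventually_mem (mem_chart_source _ y₀)).and
      ((continuousAt_extChartAt y₀).eventually_mem (hv.mem_nhds hv0))
  refine ⟨g ∘ φ, ?_, ?_⟩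
  · filter_upwards [eventually_eventually_nhds.2 hev] with y hy
    have hys := hy.self_of_nhds
    have h4 : ContMDiffWithinAt 𝓘(ℝ, EuclideanSpace ℝ (Fin k)) 𝓘(ℝ, F) ∞ g
        (Set.range (𝓡∂ k) ∩ v) (φ y) :=
      (hg (φ y) ⟨Set.mem_range_self _, hys.2⟩).contMDiffWithinAt
    have h5 : ContMDiffAt (𝓡∂ k) 𝓘(ℝ, EuclideanSpace ℝ (Fin k)) ∞ φ y :=
      contMDiffAt_extChartAt' hys.1
    have h6 := h4.comp y (h5.contMDiffWithinAt (s := {x | x ∈ (chartAt (EuclideanHalfSpace k) y₀).source ∧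
      φ x ∈ v})) (fun x hx => ⟨Set.mem_range_self _, hx.2⟩)
    exact h6.contMDiffAt hy
  · filter_upwards [hev] with y hy
    have h7 := hgf (φ y) ⟨Set.mem_range_self _, hy.2⟩
    rw [Function.comp_apply, φ.left_inv (by rw [hφ, extChartAt_source]; exact hy.1)] at h7
    exact h7

variable [T2Space Y]

/-- A cutoff of the boundary coordinate t lies in the vanishing ideal, so V(t) vanishes on ∂Y near
y₀ and Hadamard's lemma divides it by t. -/
theorem exists_dirDeriv_boundaryCoord_eq_mul {V : VField (𝓡∂ k) Y}
    (hV : V ∈ logFields (I := 𝓡∂ k) ((𝓡∂ k).boundary Y)) {y₀ : Y}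
    (hy₀ : y₀ ∈ (𝓡∂ k).boundary Y) :
    ∃ w : Y → ℝ, (∀ᶠ y in 𝓝 y₀, ContMDiffAt (𝓡∂ k) 𝓘(ℝ, ℝ) ∞ w y) ∧
      ∀ᶠ y in 𝓝 y₀, dirDeriv (𝓡∂ k) (boundaryCoord k y₀) y (V y) = boundaryCoord k y₀ y * w y := by
  have hsn : (chartAt (EuclideanHalfSpace k) y₀).source ∈ 𝓝 y₀ :=
    (chartAt (EuclideanHalfSpace k) y₀).open_source.mem_nhds (mem_chart_source _ y₀)
  obtain ⟨χ, hχ1, hχ⟩ := exists_smoothFun_eventuallyEq_one (I := 𝓡∂ k) hsn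
  let t : SmoothFun (𝓡∂ k) Y := ⟨fun y => χ y • boundaryCoord k y₀ y,
    contMDiff_smul_of_tsupport χ fun q hq => contMDiffAt_boundaryCoord (hχ hq)⟩
  have ht : t ∈ vanishingIdeal ((𝓡∂ k).boundary Y) := by
    intro y hy
    change χ y • boundaryCoord k y₀ y = 0
    by_cases hyχ : y ∈ tsupport χ
    · rw [(mem_boundary_iff_boundaryCoord_eq_zero (hχ hyχ)).1 hy, smul_zero]
    · rw [image_eq_zero_of_notMem_tsupport hyχ, zero_smul]
  obtain ⟨g, hg, hgV⟩ := hV t ht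
  have heq : ∀ᶠ y in 𝓝 y₀, dirDeriv (𝓡∂ k) (boundaryCoord k y₀) y (V y) = g y := by
    filter_upwards [eventually_eventually_nhds.2 hχ1] with y hy
    rw [hgV y]
    refine dirDeriv_congr ?_ (V y)
    filter_upwards [hy] with x hx
    change _ = χ x • boundaryCoord k y₀ x
    rw [hx, one_smul]
  obtain ⟨w, hw, hgw⟩ := exists_eq_boundaryCoord_smul hy₀ (f := g)
    (Filter.Eventually.of_forall fun y => g.contMDiff.contMDiffAt)
    (Filter.Eventually.of_forall fun y hy => hg y hy)
  refine ⟨w, hw, ?_⟩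
  filter_upwards [heq, hgw] with y h1 h2
  rw [h1, h2, smul_eq_mul]

/-- A logarithmic field maps a complex function vanishing to first order along the boundary to a
multiple of that function. -/
theorem exists_dirDeriv_eq_mul_of_mem_logFields {V : VField (𝓡∂ k) Y}
    (hV : V ∈ logFields (I := 𝓡∂ k) ((𝓡∂ k).boundary Y)) {y₀ : Y}
    (hy₀ : y₀ ∈ (𝓡∂ k).boundary Y) {σ : Y → ℂ}
    (hσ : ∀ᶠ y in 𝓝 y₀, ContMDiffAt (𝓡∂ k) 𝓘(ℝ, ℂ) ∞ σ y)
    (hσ0 : ∀ᶠ y in 𝓝 y₀, y ∈ (𝓡∂ k).boundary Y → σ y = 0)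
    (hdσ : ∃ v, dirDeriv (𝓡∂ k) σ y₀ v ≠ 0) :
    ∃ c : Y → ℂ, (∀ᶠ y in 𝓝 y₀, ContMDiffAt (𝓡∂ k) 𝓘(ℝ, ℂ) ∞ c y) ∧
      ∀ᶠ y in 𝓝 y₀, dirDeriv (𝓡∂ k) σ y (V y) = c y * σ y := by
  obtain ⟨τ, hτ, hστ⟩ := exists_eq_boundaryCoord_smul hy₀ hσ hσ0
  obtain ⟨w, hw, hVw⟩ := exists_dirDeriv_boundaryCoord_eq_mul hV hy₀
  have hsrc : ∀ᶠ y in 𝓝 y₀, y ∈ (chartAt (EuclideanHalfSpace k) y₀).source :=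
    (chartAt (EuclideanHalfSpace k) y₀).open_source.eventually_mem (mem_chart_source _ y₀)
  have hprod : ∀ y, (∀ᶠ x in 𝓝 y, σ x = boundaryCoord k y₀ x • τ x) →
      ContMDiffAt (𝓡∂ k) 𝓘(ℝ, ℂ) ∞ τ y → y ∈ (chartAt (EuclideanHalfSpace k) y₀).source →
      ∀ v, dirDeriv (𝓡∂ k) σ y v = boundaryCoord k y₀ y * dirDeriv (𝓡∂ k) τ y v +
        dirDeriv (𝓡∂ k) (boundaryCoord k y₀) y v * τ y := by
    intro y h1 h2 h3 v
    have ht : MDifferentiableAt (𝓡∂ k) 𝓘(ℝ, ℝ) (boundaryCoord k y₀) y :=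
      (contMDiffAt_boundaryCoord h3).mdifferentiableAt (by simp)
    have hc : MDifferentiableAt (𝓡∂ k) 𝓘(ℝ, ℂ)
        (fun x => Complex.ofRealCLM (boundaryCoord k y₀ x)) y :=
      (Complex.ofRealCLM.hasMFDerivAt (x := boundaryCoord k y₀ y)).mdifferentiableAt.comp y ht
    have he : σ =ᶠ[𝓝 y] fun x => Complex.ofRealCLM (boundaryCoord k y₀ x) * τ x := by
      filter_upwards [h1] with x hx
      rw [hx, Complex.real_smul]
      rfl
    rw [dirDeriv_congr he, dirDeriv_mul hc (h2.mdifferentiableAt (by simp)),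
      dirDeriv_clm_comp _ ht]
    rfl
  -- At y₀ the coordinate t vanishes, so dσ = τ dt there, and dσ ≠ 0 forces τ ≠ 0.
  have hτ0 : τ y₀ ≠ 0 := by
    intro h0
    obtain ⟨v, hv⟩ := hdσ
    refine hv ?_
    rw [hprod y₀ hστ hτ.self_of_nhds (mem_chart_source _ y₀), h0,
      (mem_boundary_iff_boundaryCoord_eq_zero (mem_chart_source _ y₀)).1 hy₀]
    simp
  have hτne : ∀ᶠ y in 𝓝 y₀, τ y ≠ 0 := hτ.self_of_nhds.continuousAt.eventually_ne hτ0
  -- From V(tτ) = twτ + tV(τ), divided by tτ.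
  refine ⟨fun y => w y + dirDeriv (𝓡∂ k) τ y (V y) / τ y, ?_, ?_⟩
  · filter_upwards [hτ, hw, hτne] with y h1 h2 h3
    exact (Complex.ofRealCLM.contDiff.contMDiff.contMDiffAt.comp y h2).add
      (contMDiffAt_complex_div (V.contMDiffAt_dirDeriv h1) h1 h3)
  · filter_upwards [hτ, hVw, hτne, hsrc, eventually_eventually_nhds.2 hστ] with y h1 h2 h3 h4 h5
    rw [hprod y h5 h1 h4, h2, h5.self_of_nhds, Complex.real_smul]
    push_cast
    field_simp
    ring

end BoundaryCoordinate

/-! ### Expansion in frames and uniqueness of values along a map -/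

set_option linter.unusedSectionVars false

namespace ComplexDivisor

variable {E : Type} [NormedAddCommGroup E] [NormedSpace ℝ E] [FiniteDimensional ℝ E]
  {M : Type*} [TopologicalSpace M] [ChartedSpace E M]
  [IsManifold 𝓘(ℝ, E) ∞ M] [T2Space M]
  {U : M → Type*} [TopologicalSpace (TotalSpace ℂ U)] [∀ p, AddCommGroup (U p)]
  [∀ p, Module ℂ (U p)] [∀ p, TopologicalSpace (U p)] [FiberBundle ℂ U]
  [VectorBundle ℂ ℂ U] [VectorBundle ℝ ℂ U] [ContMDiffVectorBundle ∞ ℂ U 𝓘(ℝ, E)]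
  (D : ComplexDivisor 𝓘(ℝ, E) U)

theorem exists_dirDeriv_localRep_eq_mul' {X : VField 𝓘(ℝ, E) M} (hX : X ∈ D.ellipticFields)
    (p : M) :
    ∃ c : M → ℂ, (∀ᶠ q in 𝓝 p, ContMDiffAt 𝓘(ℝ, E) 𝓘(ℝ, ℂ) ∞ c q) ∧
      ∀ᶠ q in 𝓝 p, dirDeriv 𝓘(ℝ, E) (D.localRep p) q (X q) = c q * D.localRep p q := by
  by_cases hp : p ∈ D.locus
  · exact D.exists_dirDeriv_localRep_eq_mul hX hp
  · have hpW : p ∈ (trivializationAt ℂ U p).baseSet :=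
      FiberBundle.mem_baseSet_trivializationAt' p
    have hev := ((trivializationAt ℂ U p).open_baseSet.eventually_mem hpW).and
      ((D.contMDiffAt_localRep hpW).continuousAt.eventually_ne
        fun h => hp ((D.localRep_eq_zero_iff hpW).1 h))
    refine ⟨fun q => dirDeriv 𝓘(ℝ, E) (D.localRep p) q (X q) / D.localRep p q, ?_, ?_⟩
    · filter_upwards [hev] with q hq
      exact contMDiffAt_complex_div (X.contMDiffAt_dirDeriv (D.contMDiffAt_localRep hq.1))
        (D.contMDiffAt_localRep hq.1) hq.2
    · filter_upwards [hev] with q hq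
      rw [div_mul_cancel₀ _ hq.2]

/-- The coefficients Λ(c, dθ(w)) are smooth near n₀ and are replaced by global functions with the
same germs. Used with j = id for elliptic fields and with j = ι for pushforwards. -/
theorem exists_coeff_along {E' : Type*} [NormedAddCommGroup E'] [NormedSpace ℝ E']
    [FiniteDimensional ℝ E'] {H' : Type*} [TopologicalSpace H'] {I' : ModelWithCorners ℝ E' H'}
    {N : Type*} [TopologicalSpace N] [ChartedSpace H' N] [IsManifold I' ∞ N] [T2Space N]
    {j : N → M} {n₀ : N} (hj : ContinuousAt j n₀) {w : ∀ n, TangentSpace 𝓘(ℝ, E) (j n)}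
    {r : ℕ} {e : Fin r → D.ellipticFields} {θ : M → E} {Λ : ℂ × E →ₗ[ℝ] (Fin r → ℝ)}
    (hΛ : ∀ᶠ q in 𝓝 (j n₀), ∀ c w,
      dirDeriv 𝓘(ℝ, E) (D.localRep (j n₀)) q w = c * D.localRep (j n₀) q →
        w = ∑ i, Λ (c, dirDeriv 𝓘(ℝ, E) θ q w) i • (e i : VField 𝓘(ℝ, E) M) q)
    {c : N → ℂ} (hc : ∀ᶠ n in 𝓝 n₀, ContMDiffAt I' 𝓘(ℝ, ℂ) ∞ c n)
    (hw : ∀ᶠ n in 𝓝 n₀,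
      ContMDiffAt I' 𝓘(ℝ, E) ∞ (fun n => dirDeriv 𝓘(ℝ, E) θ (j n) (w n)) n)
    (hcw : ∀ᶠ n in 𝓝 n₀,
      dirDeriv 𝓘(ℝ, E) (D.localRep (j n₀)) (j n) (w n) = c n * D.localRep (j n₀) (j n)) :
    ∃ g : Fin r → SmoothFun I' N, ∀ᶠ n in 𝓝 n₀,
      w n = ∑ i, g i n • (e i : VField 𝓘(ℝ, E) M) (j n) := by
  have hs : ∀ i, ∃ g : SmoothFun I' N, ∀ᶠ n in 𝓝 n₀,
      g n = Λ (c n, dirDeriv 𝓘(ℝ, E) θ (j n) (w n)) i := fun i => by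
    refine exists_smoothFun_eventuallyEq ?_
    filter_upwards [hc, hw] with n h1 h2
    have h3 : ContDiff ℝ ∞ fun x : ℂ × E => Λ x i :=
      ((ContinuousLinearMap.proj (R := ℝ) (φ := fun _ : Fin r => ℝ) i).comp
        Λ.toContinuousLinearMap).contDiff
    exact h3.contMDiff.contMDiffAt.comp n (h1.prodMk_space h2)
  choose g hg using hs
  refine ⟨g, ?_⟩
  filter_upwards [hj.eventually hΛ, hcw, Filter.eventually_all.2 hg] with n h1 h2 h3
  refine (h1 (c n) (w n) h2).trans (Finset.sum_congr rfl fun i _ => ?_)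
  rw [h3 i]

/-- Elliptic fields expand in a local frame. -/
theorem exists_coeff {p : M} {r : ℕ} {e : Fin r → D.ellipticFields} {θ : M → E}
    {Λ : ℂ × E →ₗ[ℝ] (Fin r → ℝ)} (hθ : ∀ᶠ q in 𝓝 p, ContMDiffAt 𝓘(ℝ, E) 𝓘(ℝ, E) ∞ θ q)
    (hΛ : ∀ᶠ q in 𝓝 p, ∀ c w,
      dirDeriv 𝓘(ℝ, E) (D.localRep p) q w = c * D.localRep p q →
        w = ∑ i, Λ (c, dirDeriv 𝓘(ℝ, E) θ q w) i • (e i : VField 𝓘(ℝ, E) M) q)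
    (X : D.ellipticFields) :
    ∃ g : Fin r → SmoothFun 𝓘(ℝ, E) M, ∀ᶠ q in 𝓝 p,
      (X : VField 𝓘(ℝ, E) M) q = ∑ i, g i q • (e i : VField 𝓘(ℝ, E) M) q := by
  obtain ⟨c, hc, hcX⟩ := D.exists_dirDeriv_localRep_eq_mul' X.2 p
  refine D.exists_coeff_along (j := id) (n₀ := p) continuousAt_id
    (w := fun q => (X : VField 𝓘(ℝ, E) M) q) hΛ hc ?_ hcX
  filter_upwards [hθ] with q hq
  exact VField.contMDiffAt_dirDeriv (X : VField 𝓘(ℝ, E) M) hq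

/-- Off D the frame is independent as tangent vectors, so X_p = 0 kills the frame coefficients of X
at p, and these determine its fibre value. -/
theorem anchor_injective {p : M} (hp : p ∉ D.locus) :
    Function.Injective (anchor D.ellipticFields p) := by
  rw [← LinearMap.ker_eq_bot, LinearMap.ker_eq_bot']
  intro v hv
  obtain ⟨X, rfl⟩ := fibreEval_surjective D.ellipticFields p v
  obtain ⟨r, e, θ, Λ, hθ, hind, hΛ⟩ := D.exists_frame p
  obtain ⟨g, hg⟩ := D.exists_coeff hθ hΛ X
  have h1 := Fintype.linearIndependent_iff.1 (hind.self_of_nhds hp) (fun i => g i p)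
    (hg.self_of_nhds.symm.trans hv)
  rw [fibreEval_eq_sum D.ellipticFields hg]
  exact Finset.sum_eq_zero fun i _ => by rw [h1 i, zero_smul]

section Along

variable {E' : Type*} [NormedAddCommGroup E'] [NormedSpace ℝ E']
  {H' : Type*} [TopologicalSpace H'] (I' : ModelWithCorners ℝ E' H')
  {N : Type*} [TopologicalSpace N] [ChartedSpace H' N]

/-- Expand each X_j in a frame at ι(n₀). The total coefficients are continuous on N and vanish off D
near n₀ by independence of the frame, hence also at n₀ by density. The fibre value at n₀ is the
combination with these coefficients; independence of the frame over D is not needed. -/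
theorem sum_smul_fibreEval_eq_zero {ι : N → M} (hι : Continuous ι)
    (hdense : Dense (ι ⁻¹' D.locus)ᶜ) {n₀ : N} {r : ℕ} {f : Fin r → SmoothFun I' N}
    {X : Fin r → D.ellipticFields}
    (h : ∀ᶠ n in 𝓝 n₀, ι n ∉ D.locus →
      (0 : TangentSpace 𝓘(ℝ, E) (ι n)) = ∑ j, f j n • (X j : VField 𝓘(ℝ, E) M) (ι n)) :
    ∑ j, f j n₀ • fibreEval D.ellipticFields (ι n₀) (X j) = 0 := by
  obtain ⟨s, e, θ, Λ, hθ, hind, hΛ⟩ := D.exists_frame (ι n₀)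
  choose g hg using fun j => D.exists_coeff hθ hΛ (X j)
  have hcont : ∀ i, Continuous fun n => ∑ j, f j n * g j i (ι n) := fun i =>
    continuous_finsetSum _ fun j _ =>
      (f j).contMDiff.continuous.mul ((g j i).contMDiff.continuous.comp hι)
  have hzero : ∀ i, ∑ j, f j n₀ * g j i (ι n₀) = 0 := by
    intro i
    have hev : ∀ᶠ n in 𝓝 n₀, ι n ∉ D.locus → ∑ j, f j n * g j i (ι n) = 0 := by
      filter_upwards [h, hι.continuousAt.eventually hind,
        hι.continuousAt.eventually (Filter.eventually_all.2 hg)] with n h1 h2 h3 hn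
      refine Fintype.linearIndependent_iff.1 (h2 hn)
        (fun i => ∑ j, f j n * g j i (ι n)) ?_ i
      rw [eq_comm, h1 hn]
      simp only [Finset.sum_smul, mul_smul]
      rw [Finset.sum_comm]
      refine Finset.sum_congr rfl fun j _ => ?_
      rw [h3 j, Finset.smul_sum]
    by_contra hne
    have h4 := ((hcont i).continuousAt.eventually_ne hne).and hev
    obtain ⟨n, hn, hnD⟩ := mem_closure_iff_nhds.1 (hdense n₀) _ h4
    exact hn.1 (hn.2 hnD)
  have h5 : ∀ j, fibreEval D.ellipticFields (ι n₀) (X j) =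
      ∑ i, g j i (ι n₀) • fibreEval D.ellipticFields (ι n₀) (e i) := fun j =>
    fibreEval_eq_sum D.ellipticFields (hg j)
  simp only [h5, Finset.smul_sum, smul_smul]
  rw [Finset.sum_comm]
  refine Finset.sum_eq_zero fun i _ => ?_
  rw [← Finset.sum_smul, hzero i, zero_smul]

/-- The vector field `w` along `ι` is, near `n₀` and off the divisor, the image under the anchor of
a smooth section along `ι` of the elliptic tangent bundle with value `z` at `n₀`. -/
def IsValueAlong (ι : N → M) (n₀ : N) (w : ∀ n, TangentSpace 𝓘(ℝ, E) (ι n))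
    (z : Fibre D.ellipticFields (ι n₀)) : Prop :=
  ∃ (r : ℕ) (f : Fin r → SmoothFun I' N) (X : Fin r → D.ellipticFields),
    (∀ᶠ n in 𝓝 n₀, ι n ∉ D.locus → w n = ∑ j, f j n • (X j : VField 𝓘(ℝ, E) M) (ι n)) ∧
    z = ∑ j, f j n₀ • fibreEval D.ellipticFields (ι n₀) (X j)

variable {D I'} {ι : N → M} {n₀ : N} {w w' : ∀ n, TangentSpace 𝓘(ℝ, E) (ι n)}
  {z z' : Fibre D.ellipticFields (ι n₀)}

theorem IsValueAlong.add (h : D.IsValueAlong I' ι n₀ w z) (h' : D.IsValueAlong I' ι n₀ w' z') :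
    D.IsValueAlong I' ι n₀ (fun n => w n + w' n) (z + z') := by
  obtain ⟨r, f, X, hw, rfl⟩ := h
  obtain ⟨r', f', X', hw', rfl⟩ := h'
  refine ⟨r + r', Fin.append f f', Fin.append X X', ?_, ?_⟩
  · filter_upwards [hw, hw'] with n h1 h2 hn
    rw [h1 hn, h2 hn, Fin.sum_univ_add]
    simp only [Fin.append_left, Fin.append_right]
  · rw [Fin.sum_univ_add]
    simp only [Fin.append_left, Fin.append_right]

theorem IsValueAlong.smul (h : D.IsValueAlong I' ι n₀ w z) (a : SmoothFun I' N) :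
    D.IsValueAlong I' ι n₀ (fun n => a n • w n) (a n₀ • z) := by
  obtain ⟨r, f, X, hw, rfl⟩ := h
  refine ⟨r, fun j => a * f j, X, ?_, ?_⟩
  · filter_upwards [hw] with n h1 hn
    rw [h1 hn, Finset.smul_sum]
    exact Finset.sum_congr rfl fun j _ => (mul_smul (a n) (f j n) _).symm
  · rw [Finset.smul_sum]
    exact Finset.sum_congr rfl fun j _ => (mul_smul (a n₀) (f j n₀) _).symm

theorem IsValueAlong.const_smul (h : D.IsValueAlong I' ι n₀ w z) (a : ℝ) :
    D.IsValueAlong I' ι n₀ (fun n => a • w n) (a • z) :=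
  h.smul ⟨fun _ => a, contMDiff_const⟩

theorem IsValueAlong.unique (hι : Continuous ι) (hdense : Dense (ι ⁻¹' D.locus)ᶜ)
    (h : D.IsValueAlong I' ι n₀ w z) (h' : D.IsValueAlong I' ι n₀ w z') : z = z' := by
  obtain ⟨r, f, X, hw, hz⟩ := h.add (h'.const_smul (-1))
  have h0 := D.sum_smul_fibreEval_eq_zero I' hι hdense (n₀ := n₀) (f := f) (X := X) (by
    filter_upwards [hw] with n hn hnD
    rw [← hn hnD, neg_one_smul, add_neg_cancel])
  rw [← hz, neg_one_smul, add_neg_eq_zero] at h0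
  exact h0

end Along

end ComplexDivisor

/-! ### Existence of the pushforward -/

set_option linter.unusedSectionVars false

namespace ComplexDivisor

variable {E : Type} [NormedAddCommGroup E] [NormedSpace ℝ E] [FiniteDimensional ℝ E]
  {M : Type*} [TopologicalSpace M] [ChartedSpace E M]
  [IsManifold 𝓘(ℝ, E) ∞ M] [T2Space M]
  {U : M → Type*} [TopologicalSpace (TotalSpace ℂ U)] [∀ p, AddCommGroup (U p)]
  [∀ p, Module ℂ (U p)] [∀ p, TopologicalSpace (U p)] [FiberBundle ℂ U]
  [VectorBundle ℂ ℂ U] [VectorBundle ℝ ℂ U] [ContMDiffVectorBundle ∞ ℂ U 𝓘(ℝ, E)]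
  (D : ComplexDivisor 𝓘(ℝ, E) U)
  {k : ℕ} [NeZero k] {Y : Type*} [TopologicalSpace Y]
  [ChartedSpace (EuclideanHalfSpace k) Y] [IsManifold (𝓡∂ k) ∞ Y] [T2Space Y]

/-- The pushforward of a logarithmic field is locally a combination of elliptic fields. -/
theorem exists_pushforward_eq_sum {ι : Y → M} (hι : ContMDiff (𝓡∂ k) 𝓘(ℝ, E) ∞ ι)
    (himm : ∀ y, Function.Injective (mfderiv (𝓡∂ k) 𝓘(ℝ, E) ι y))
    (hbd : (𝓡∂ k).boundary Y = ι ⁻¹' D.locus)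
    (hclean : ∀ y ∈ (𝓡∂ k).boundary Y,
      (boundaryTangent y).map (mfderiv (𝓡∂ k) 𝓘(ℝ, E) ι y).toLinearMap =
        LinearMap.range (mfderiv (𝓡∂ k) 𝓘(ℝ, E) ι y).toLinearMap ⊓ D.tangent (ι y))
    {V : VField (𝓡∂ k) Y} (hV : V ∈ logFields (I := 𝓡∂ k) (ι ⁻¹' D.locus)) (y₀ : Y) :
    ∃ (r : ℕ) (f : Fin r → SmoothFun (𝓡∂ k) Y) (X : Fin r → D.ellipticFields),
      ∀ᶠ y in 𝓝 y₀, mfderiv (𝓡∂ k) 𝓘(ℝ, E) ι y (V y) =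
        ∑ j, f j y • (X j : VField 𝓘(ℝ, E) M) (ι y) := by
  rw [← hbd] at hV
  obtain ⟨r, e, θ, Λ, hθ, -, hΛ⟩ := D.exists_frame (ι y₀)
  have hιd : ∀ y, MDifferentiableAt (𝓡∂ k) 𝓘(ℝ, E) ι y := fun y =>
    hι.contMDiffAt.mdifferentiableAt (by simp)
  have hιc : Continuous ι := hι.continuous
  set σ : Y → ℂ := fun y => D.localRep (ι y₀) (ι y) with hσdef
  have hW : ∀ᶠ y in 𝓝 y₀, ι y ∈ (trivializationAt ℂ U (ι y₀)).baseSet :=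
    hιc.continuousAt.eventually ((trivializationAt ℂ U (ι y₀)).open_baseSet.eventually_mem
      (FiberBundle.mem_baseSet_trivializationAt' (ι y₀)))
  have hσ : ∀ᶠ y in 𝓝 y₀, ContMDiffAt (𝓡∂ k) 𝓘(ℝ, ℂ) ∞ σ y := by
    filter_upwards [hW] with y hy using (D.contMDiffAt_localRep hy).comp y hι.contMDiffAt
  have hdσ : ∀ y, ι y ∈ (trivializationAt ℂ U (ι y₀)).baseSet → ∀ v,
      dirDeriv (𝓡∂ k) σ y v =
        dirDeriv 𝓘(ℝ, E) (D.localRep (ι y₀)) (ι y) (mfderiv (𝓡∂ k) 𝓘(ℝ, E) ι y v) :=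
    fun y hy v => dirDeriv_comp ((D.contMDiffAt_localRep hy).mdifferentiableAt (by simp)) (hιd y) v
  have hc : ∃ c : Y → ℂ, (∀ᶠ y in 𝓝 y₀, ContMDiffAt (𝓡∂ k) 𝓘(ℝ, ℂ) ∞ c y) ∧
      ∀ᶠ y in 𝓝 y₀, dirDeriv (𝓡∂ k) σ y (V y) = c y * σ y := by
    by_cases hy₀ : y₀ ∈ (𝓡∂ k).boundary Y
    · refine exists_dirDeriv_eq_mul_of_mem_logFields hV hy₀ hσ ?_ ?_
      · filter_upwards [hW] with y hy hyb
        rw [hbd] at hyb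
        exact (D.localRep_eq_zero_iff hy).2 hyb
      -- If d(σ∘ι) vanished at y₀, dι would map all of TY into TD; the clean intersection and
      -- injectivity of dι would then make every tangent vector tangent to ∂Y.
      · by_contra hne
        push Not at hne
        refine boundaryTangent_ne_top (k := k) y₀ (Submodule.eq_top_iff'.2 fun v => ?_)
        have hmem : mfderiv (𝓡∂ k) 𝓘(ℝ, E) ι y₀ v ∈
            LinearMap.range (mfderiv (𝓡∂ k) 𝓘(ℝ, E) ι y₀).toLinearMap ⊓ D.tangent (ι y₀) :=
          ⟨⟨v, rfl⟩, (hdσ y₀ hW.self_of_nhds v).symm.trans (hne v)⟩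
        rw [← hclean y₀ hy₀] at hmem
        obtain ⟨v', hv', hvv'⟩ := hmem
        rwa [← himm y₀ hvv']
    · have hne : σ y₀ ≠ 0 := fun h => hy₀ (by
        rw [hbd]
        exact (D.localRep_eq_zero_iff hW.self_of_nhds).1 h)
      have hne' := hσ.self_of_nhds.continuousAt.eventually_ne hne
      refine ⟨fun y => dirDeriv (𝓡∂ k) σ y (V y) / σ y, ?_, ?_⟩
      · filter_upwards [hσ, hne'] with y h1 h2
        exact contMDiffAt_complex_div (V.contMDiffAt_dirDeriv h1) h1 h2
      · filter_upwards [hne'] with y h2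
        rw [div_mul_cancel₀ _ h2]
  obtain ⟨c, hc, hcV⟩ := hc
  obtain ⟨g, hg⟩ := D.exists_coeff_along (j := ι) hιc.continuousAt
    (w := fun y => mfderiv (𝓡∂ k) 𝓘(ℝ, E) ι y (V y)) hΛ hc (by
      filter_upwards [hιc.continuousAt.eventually (eventually_eventually_nhds.2 hθ)] with y hy
      have h1 : ContMDiffAt (𝓡∂ k) 𝓘(ℝ, E) ∞ (fun y => θ (ι y)) y :=
        hy.self_of_nhds.comp y hι.contMDiffAt
      refine (V.contMDiffAt_dirDeriv h1).congr_of_eventuallyEq ?_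
      -- By the chain rule dθ(dι V) is the derivative of θ∘ι along V, a smooth function on Y.
      filter_upwards [hιc.continuousAt.eventually hy] with x hx
      exact (dirDeriv_comp (hx.mdifferentiableAt (by simp)) (hιd x) (V x)).symm) (by
      filter_upwards [hW, hcV] with y h1 h2
      exact (hdσ y h1 (V y)).symm.trans h2)
  exact ⟨r, g, e, hg⟩

/-- A smooth bundle map to the pullback of the elliptic tangent bundle pulls elliptic forms back to
smooth forms. -/
theorem contMDiff_form_apply {E' : Type*} [NormedAddCommGroup E'] [NormedSpace ℝ E']
    {H' : Type*} [TopologicalSpace H'] {I' : ModelWithCorners ℝ E' H'}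
    {N : Type*} [TopologicalSpace N] [ChartedSpace H' N] {ι : N → M}
    (hι : ContMDiff I' 𝓘(ℝ, E) ∞ ι) {q : ℕ} (α : Form D.ellipticFields q)
    {s : Fin q → ∀ n, Fibre D.ellipticFields (ι n)}
    (hs : ∀ i, IsSmoothSectionAlong D.ellipticFields I' ι (s i)) :
    ContMDiff I' 𝓘(ℝ, ℝ) ∞ fun n => α.1 (ι n) fun i => s i n := by
  intro n₀
  choose r f X h using fun i => hs i n₀
  -- J selects one summand of each section in the multilinear expansion of α.
  have hterm : ∀ J : ∀ i, Fin (r i), ContMDiffAt I' 𝓘(ℝ, ℝ) ∞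
      (fun n => (∏ i, f i (J i) n) *
        α.1 (ι n) fun i => fibreEval D.ellipticFields (ι n) (X i (J i))) n₀ := fun J =>
    (contMDiffAt_finsetProd fun i _ => (f i (J i)).contMDiff.contMDiffAt).mul
      ((α.2 fun i => X i (J i)).contMDiffAt.comp n₀ hι.contMDiffAt)
  have hsum : ContMDiffAt I' 𝓘(ℝ, ℝ) ∞
      (fun n => ∑ J : ∀ i, Fin (r i), (∏ i, f i (J i) n) *
        α.1 (ι n) fun i => fibreEval D.ellipticFields (ι n) (X i (J i))) n₀ :=
    contMDiffAt_finsetSum fun J _ => hterm J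
  refine hsum.congr_of_eventuallyEq ?_
  filter_upwards [Filter.eventually_all.2 h] with n hn
  have h1 : (fun i => s i n) =
      fun i => ∑ j, f i j n • fibreEval D.ellipticFields (ι n) (X i j) := funext hn
  rw [h1]
  refine ((α.1 (ι n)).toMultilinearMap.map_sum
    (fun i j => f i j n • fibreEval D.ellipticFields (ι n) (X i j))).trans ?_
  refine Finset.sum_congr rfl fun J _ => ?_
  exact (α.1 (ι n)).toMultilinearMap.map_smul_univ (fun i => f i (J i) n)
    fun i => fibreEval D.ellipticFields (ι n) (X i (J i))

/-- The values are chosen pointwise. Their uniqueness makes the choice linear over smooth functions,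
so it kills 𝔪_y times the logarithmic fields and descends to the fibre. -/
theorem exists_pushforward {ι : Y → M} (hι : ContMDiff (𝓡∂ k) 𝓘(ℝ, E) ∞ ι)
    (himm : ∀ y, Function.Injective (mfderiv (𝓡∂ k) 𝓘(ℝ, E) ι y))
    (hbd : (𝓡∂ k).boundary Y = ι ⁻¹' D.locus)
    (hclean : ∀ y ∈ (𝓡∂ k).boundary Y,
      (boundaryTangent y).map (mfderiv (𝓡∂ k) 𝓘(ℝ, E) ι y).toLinearMap =
        LinearMap.range (mfderiv (𝓡∂ k) 𝓘(ℝ, E) ι y).toLinearMap ⊓ D.tangent (ι y)) :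
    ∃ Φ : (y : Y) → Fibre (logFields (I := 𝓡∂ k) (ι ⁻¹' D.locus)) y →ₗ[ℝ]
        Fibre D.ellipticFields (ι y),
      ∀ (y : Y) (V : logFields (I := 𝓡∂ k) (ι ⁻¹' D.locus)),
        D.IsValueAlong (𝓡∂ k) ι y
          (fun x => mfderiv (𝓡∂ k) 𝓘(ℝ, E) ι x ((V : VField (𝓡∂ k) Y) x))
          (Φ y (fibreEval _ y V)) := by
  set 𝓕 := logFields (I := 𝓡∂ k) (ι ⁻¹' D.locus) with h𝓕
  have hdense : Dense (ι ⁻¹' D.locus)ᶜ := hbd ▸ dense_compl_boundary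
  have hex : ∀ (y : Y) (V : 𝓕), ∃ z, D.IsValueAlong (𝓡∂ k) ι y
      (fun x => mfderiv (𝓡∂ k) 𝓘(ℝ, E) ι x ((V : VField (𝓡∂ k) Y) x)) z := fun y V => by
    obtain ⟨r, f, X, h⟩ := D.exists_pushforward_eq_sum hι himm hbd hclean V.2 y
    exact ⟨_, r, f, X, h.mono fun _ hx _ => hx, rfl⟩
  choose φ hφ using hex
  have hφadd : ∀ y V V', φ y (V + V') = φ y V + φ y V' := fun y V V' => by
    refine (hφ y (V + V')).unique hι.continuous hdense ?_
    convert! (hφ y V).add (hφ y V') using 2 with x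
    exact map_add (mfderiv (𝓡∂ k) 𝓘(ℝ, E) ι x) _ _
  have hφsmul : ∀ (y : Y) (a : SmoothFun (𝓡∂ k) Y) (V : 𝓕), φ y (a • V) = a y • φ y V :=
    fun y a V => by
    refine (hφ y (a • V)).unique hι.continuous hdense ?_
    convert! (hφ y V).smul a using 2 with x
    exact map_smul (mfderiv (𝓡∂ k) 𝓘(ℝ, E) ι x) (a x) _
  have hφconst : ∀ (y : Y) (a : ℝ) (V : 𝓕), φ y (a • V) = a • φ y V :=
    fun y a V => by
    refine (hφ y (a • V)).unique hι.continuous hdense ?_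
    convert! (hφ y V).const_smul a using 2 with x
    exact map_smul (mfderiv (𝓡∂ k) 𝓘(ℝ, E) ι x) a _
  let L : (y : Y) → 𝓕 →ₗ[ℝ] Fibre D.ellipticFields (ι y) := fun y =>
    { toFun := φ y, map_add' := hφadd y, map_smul' := hφconst y }
  have hL : ∀ y, fibreKernel 𝓕 y ≤ LinearMap.ker (L y) := by
    intro y V hV
    change V ∈ (vanishingIdeal {y} : Ideal (SmoothFun (𝓡∂ k) Y)) •
      (⊤ : Submodule (SmoothFun (𝓡∂ k) Y) 𝓕) at hV
    change φ y V = 0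
    induction hV using Submodule.smul_induction_on' with
    | smul f hf V _ => rw [hφsmul, hf y rfl, zero_smul]
    | add V _ V' _ hV hV' => rw [hφadd, hV, hV', add_zero]
  exact ⟨fun y => (fibreKernel 𝓕 y).liftQ (L y) (hL y), fun y V => hφ y V⟩

end ComplexDivisor

/-- Every fibre vector is the value of a global section, and on global sections a form is a
continuous function. -/
theorem Form.eq_of_dense {E : Type*} [NormedAddCommGroup E] [NormedSpace ℝ E] {H : Type*}
    [TopologicalSpace H] {I : ModelWithCorners ℝ E H} {M : Type*} [TopologicalSpace M]
    [ChartedSpace H M] [IsManifold I ∞ M] {𝓔 : Submodule (SmoothFun I M) (VField I M)} {q : ℕ}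
    {S : Set M} (hS : Dense S) {α β : Form 𝓔 q} (h : ∀ p ∈ S, α.1 p = β.1 p) : α = β := by
  refine Subtype.ext (funext fun p => AlternatingMap.ext fun v => ?_)
  choose V hV using fun i => fibreEval_surjective _ p (v i)
  obtain rfl : (fun i => fibreEval _ p (V i)) = v := funext hV
  refine congrFun (Continuous.ext_on hS (α.2 V).continuous (β.2 V).continuous
    fun x hx => ?_) p
  exact DFunLike.congr_fun (h x hx) _

/-! ### The bundle morphism and the pullback of forms -/

set_option linter.unusedSectionVars false

namespace ComplexDivisor

variable {E : Type} [NormedAddCommGroup E] [NormedSpace ℝ E] [FiniteDimensional ℝ E]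
  {M : Type*} [TopologicalSpace M] [ChartedSpace E M]
  [IsManifold 𝓘(ℝ, E) ∞ M] [T2Space M]
  {U : M → Type*} [TopologicalSpace (TotalSpace ℂ U)] [∀ p, AddCommGroup (U p)]
  [∀ p, Module ℂ (U p)] [∀ p, TopologicalSpace (U p)] [FiberBundle ℂ U]
  [VectorBundle ℂ ℂ U] [VectorBundle ℝ ℂ U] [ContMDiffVectorBundle ∞ ℂ U 𝓘(ℝ, E)]
  (D : ComplexDivisor 𝓘(ℝ, E) U)
  {k : ℕ} [NeZero k] {Y : Type*} [TopologicalSpace Y]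
  [ChartedSpace (EuclideanHalfSpace k) Y] [IsManifold (𝓡∂ k) ∞ Y] [T2Space Y]

/-- The pushforward as a smooth bundle map from the logarithmic to the elliptic tangent bundle. -/
theorem exists_smooth_pushforward {ι : Y → M} (hι : ContMDiff (𝓡∂ k) 𝓘(ℝ, E) ∞ ι)
    (himm : ∀ y, Function.Injective (mfderiv (𝓡∂ k) 𝓘(ℝ, E) ι y))
    (hbd : (𝓡∂ k).boundary Y = ι ⁻¹' D.locus)
    (hclean : ∀ y ∈ (𝓡∂ k).boundary Y,
      (boundaryTangent y).map (mfderiv (𝓡∂ k) 𝓘(ℝ, E) ι y).toLinearMap =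
        LinearMap.range (mfderiv (𝓡∂ k) 𝓘(ℝ, E) ι y).toLinearMap ⊓ D.tangent (ι y)) :
    ∃ Φ : (y : Y) → Fibre (logFields (I := 𝓡∂ k) (ι ⁻¹' D.locus)) y →ₗ[ℝ]
        Fibre D.ellipticFields (ι y),
      IsSmoothBundleMap D.ellipticFields ι (logFields (I := 𝓡∂ k) (ι ⁻¹' D.locus)) Φ ∧
      ∀ y v, anchor D.ellipticFields (ι y) (Φ y v) =
        mfderiv (𝓡∂ k) 𝓘(ℝ, E) ι y (anchor _ y v) := by
  have hdense : Dense (ι ⁻¹' D.locus)ᶜ := hbd ▸ dense_compl_boundary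
  have hιc : Continuous ι := hι.continuous
  obtain ⟨Φ, hΦ⟩ := D.exists_pushforward hι himm hbd hclean
  have hval : ∀ (V : logFields (I := 𝓡∂ k) (ι ⁻¹' D.locus)) (y₀ : Y),
      ∃ (r : ℕ) (f : Fin r → SmoothFun (𝓡∂ k) Y) (X : Fin r → D.ellipticFields),
        ∀ᶠ y in 𝓝 y₀,
          mfderiv (𝓡∂ k) 𝓘(ℝ, E) ι y ((V : VField (𝓡∂ k) Y) y) =
            ∑ j, f j y • (X j : VField 𝓘(ℝ, E) M) (ι y) ∧
          Φ y (fibreEval _ y V) = ∑ j, f j y • fibreEval D.ellipticFields (ι y) (X j) := by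
    intro V y₀
    obtain ⟨r, f, X, h⟩ := D.exists_pushforward_eq_sum hι himm hbd hclean V.2 y₀
    refine ⟨r, f, X, ?_⟩
    -- The expansion found at y₀ also holds near each nearby y, so by uniqueness it computes Φ
    -- there.
    filter_upwards [eventually_eventually_nhds.2 h] with y hy
    exact ⟨hy.self_of_nhds, (hΦ y V).unique hιc hdense
      ⟨r, f, X, hy.mono fun _ hx _ => hx, rfl⟩⟩
  have hsmooth : IsSmoothBundleMap D.ellipticFields ι
      (logFields (I := 𝓡∂ k) (ι ⁻¹' D.locus)) Φ := by
    intro V y₀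
    obtain ⟨r, f, X, h⟩ := hval V y₀
    exact ⟨r, f, X, h.mono fun _ hy => hy.2⟩
  have hanchor : ∀ y v, anchor D.ellipticFields (ι y) (Φ y v) =
      mfderiv (𝓡∂ k) 𝓘(ℝ, E) ι y (anchor _ y v) := by
    intro y v
    obtain ⟨V, rfl⟩ := fibreEval_surjective _ y v
    obtain ⟨r, f, X, h⟩ := hval V y
    rw [h.self_of_nhds.2, anchor_fibreEval, h.self_of_nhds.1, map_sum]
    exact Finset.sum_congr rfl fun j _ => map_smul _ _ _
  exact ⟨Φ, hsmooth, hanchor⟩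

omit [T2Space Y] in
/-- A smooth bundle map lying over the pushforward away from the divisor gives its values. -/
theorem isValueAlong_of_isSmoothBundleMap {ι : Y → M}
    {Φ : (y : Y) → Fibre (logFields (I := 𝓡∂ k) (ι ⁻¹' D.locus)) y →ₗ[ℝ]
      Fibre D.ellipticFields (ι y)}
    (hΦ : IsSmoothBundleMap D.ellipticFields ι (logFields (I := 𝓡∂ k) (ι ⁻¹' D.locus)) Φ)
    (hΦa : ∀ y ∉ ι ⁻¹' D.locus, ∀ v, anchor D.ellipticFields (ι y) (Φ y v) =
      mfderiv (𝓡∂ k) 𝓘(ℝ, E) ι y (anchor _ y v))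
    (y : Y) (V : logFields (I := 𝓡∂ k) (ι ⁻¹' D.locus)) :
    D.IsValueAlong (𝓡∂ k) ι y
      (fun x => mfderiv (𝓡∂ k) 𝓘(ℝ, E) ι x ((V : VField (𝓡∂ k) Y) x))
      (Φ y (fibreEval _ y V)) := by
  obtain ⟨r, f, X, h⟩ := hΦ V y
  refine ⟨r, f, X, ?_, h.self_of_nhds⟩
  filter_upwards [h] with x hx hxD
  have h1 := hΦa x hxD (fibreEval _ x V)
  rw [hx, anchor_fibreEval, map_sum] at h1
  exact h1.symm.trans (Finset.sum_congr rfl fun j _ => map_smul _ _ _)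

/-- A smooth bundle map lying over the pushforward is determined by this away from the divisor. -/
theorem bundleMap_unique {ι : Y → M} (hι : Continuous ι) (hdense : Dense (ι ⁻¹' D.locus)ᶜ)
    {Φ : (y : Y) → Fibre (logFields (I := 𝓡∂ k) (ι ⁻¹' D.locus)) y →ₗ[ℝ]
      Fibre D.ellipticFields (ι y)}
    (hΦ : IsSmoothBundleMap D.ellipticFields ι (logFields (I := 𝓡∂ k) (ι ⁻¹' D.locus)) Φ)
    (hΦa : ∀ y ∉ ι ⁻¹' D.locus, ∀ v, anchor D.ellipticFields (ι y) (Φ y v) =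
      mfderiv (𝓡∂ k) 𝓘(ℝ, E) ι y (anchor _ y v))
    {Ψ : (y : Y) → Fibre (logFields (I := 𝓡∂ k) (ι ⁻¹' D.locus)) y →ₗ[ℝ]
      Fibre D.ellipticFields (ι y)}
    (hΨ : IsSmoothBundleMap D.ellipticFields ι (logFields (I := 𝓡∂ k) (ι ⁻¹' D.locus)) Ψ)
    (hΨa : ∀ y ∉ ι ⁻¹' D.locus, ∀ v, anchor D.ellipticFields (ι y) (Ψ y v) =
      mfderiv (𝓡∂ k) 𝓘(ℝ, E) ι y (anchor _ y v)) : Ψ = Φ := by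
  funext y
  refine LinearMap.ext fun v => ?_
  obtain ⟨V, rfl⟩ := fibreEval_surjective _ y v
  exact (D.isValueAlong_of_isSmoothBundleMap hΨ hΨa y V).unique hι hdense
    (D.isValueAlong_of_isSmoothBundleMap hΦ hΦa y V)

/-- The pullback of elliptic forms along a smooth bundle map. -/
def pullbackForm {ι : Y → M} (hι : ContMDiff (𝓡∂ k) 𝓘(ℝ, E) ∞ ι)
    {Φ : (y : Y) → Fibre (logFields (I := 𝓡∂ k) (ι ⁻¹' D.locus)) y →ₗ[ℝ]
      Fibre D.ellipticFields (ι y)}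
    (hΦ : IsSmoothBundleMap D.ellipticFields ι (logFields (I := 𝓡∂ k) (ι ⁻¹' D.locus)) Φ)
    (q : ℕ) :
    Form D.ellipticFields q →ₗ[ℝ] Form (logFields (I := 𝓡∂ k) (ι ⁻¹' D.locus)) q where
  toFun α := ⟨fun y => (α.1 (ι y)).compLinearMap (Φ y),
    fun V => D.contMDiff_form_apply hι α fun i => hΦ (V i)⟩
  map_add' _ _ := rfl
  map_smul' _ _ := rfl

/-- The pushforward, its uniqueness, and the pullback of elliptic forms to logarithmic forms. -/
theorem exists_pushforward_pullback {ι : Y → M} (hι : ContMDiff (𝓡∂ k) 𝓘(ℝ, E) ∞ ι)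
    (himm : ∀ y, Function.Injective (mfderiv (𝓡∂ k) 𝓘(ℝ, E) ι y))
    (hbd : (𝓡∂ k).boundary Y = ι ⁻¹' D.locus)
    (hclean : ∀ y ∈ (𝓡∂ k).boundary Y,
      (boundaryTangent y).map (mfderiv (𝓡∂ k) 𝓘(ℝ, E) ι y).toLinearMap =
        LinearMap.range (mfderiv (𝓡∂ k) 𝓘(ℝ, E) ι y).toLinearMap ⊓ D.tangent (ι y)) :
    ∃ Φ : (y : Y) → Fibre (logFields (I := 𝓡∂ k) (ι ⁻¹' D.locus)) y →ₗ[ℝ]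
        Fibre D.ellipticFields (ι y),
      IsSmoothBundleMap D.ellipticFields ι (logFields (I := 𝓡∂ k) (ι ⁻¹' D.locus)) Φ ∧
      (∀ y v, anchor D.ellipticFields (ι y) (Φ y v) =
        mfderiv (𝓡∂ k) 𝓘(ℝ, E) ι y (anchor _ y v)) ∧
      (∀ Ψ : (y : Y) → Fibre (logFields (I := 𝓡∂ k) (ι ⁻¹' D.locus)) y →ₗ[ℝ]
          Fibre D.ellipticFields (ι y),
        IsSmoothBundleMap D.ellipticFields ι (logFields (I := 𝓡∂ k) (ι ⁻¹' D.locus)) Ψ →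
        (∀ y ∉ (𝓡∂ k).boundary Y, ∀ v, anchor D.ellipticFields (ι y) (Ψ y v) =
          mfderiv (𝓡∂ k) 𝓘(ℝ, E) ι y (anchor _ y v)) →
        Ψ = Φ) ∧
      ∀ q : ℕ, ∃ P : Form D.ellipticFields q →ₗ[ℝ]
          Form (logFields (I := 𝓡∂ k) (ι ⁻¹' D.locus)) q,
        (∀ α y v, (P α).1 y v = α.1 (ι y) fun i => Φ y (v i)) ∧
        (∀ α, ∀ y ∉ (𝓡∂ k).boundary Y, ∀ v w,
          (∀ i, anchor D.ellipticFields (ι y) (w i) =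
            mfderiv (𝓡∂ k) 𝓘(ℝ, E) ι y (anchor _ y (v i))) →
          (P α).1 y v = α.1 (ι y) w) ∧
        ∀ α (β : Form (logFields (I := 𝓡∂ k) (ι ⁻¹' D.locus)) q),
          (∀ y ∉ (𝓡∂ k).boundary Y, β.1 y = (P α).1 y) → β = P α := by
  have hdense : Dense (ι ⁻¹' D.locus)ᶜ := hbd ▸ dense_compl_boundary
  obtain ⟨Φ, hsmooth, hanchor⟩ := D.exists_smooth_pushforward hι himm hbd hclean
  refine ⟨Φ, hsmooth, hanchor, fun Ψ hΨ hΨa => ?_, fun q =>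
    ⟨D.pullbackForm hι hsmooth q, fun _ _ _ => rfl, fun α y hy v w hw => ?_, fun α β hβ => ?_⟩⟩
  · exact D.bundleMap_unique hι.continuous hdense hsmooth (fun y _ => hanchor y) hΨ
      fun y hy => hΨa y (by rw [hbd]; exact hy)
  · refine congrArg (α.1 (ι y)) (funext fun i => ?_)
    rw [hbd] at hy
    exact D.anchor_injective hy ((hanchor y (v i)).trans (hw i).symm)
  · exact Form.eq_of_dense hdense fun y hy => hβ y (by rw [hbd]; exact hy)

end ComplexDivisor

end EllipticGeometry

end

open EllipticGeometry in
theorem mainTheorem12 {m : ℕ} {M : Type*} [TopologicalSpace M]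
    [ChartedSpace (EuclideanSpace ℝ (Fin m)) M] [IsManifold (𝓡 m) ∞ M]
    [T2Space M] [SecondCountableTopology M]
    {U : M → Type*} [TopologicalSpace (TotalSpace ℂ U)] [∀ p, AddCommGroup (U p)]
    [∀ p, Module ℂ (U p)] [∀ p, TopologicalSpace (U p)] [FiberBundle ℂ U]
    [VectorBundle ℂ ℂ U] [VectorBundle ℝ ℂ U] [ContMDiffVectorBundle ∞ ℂ U (𝓡 m)]
    (D : ComplexDivisor (𝓡 m) U)
    {k : ℕ} [NeZero k] {Y : Type*} [TopologicalSpace Y]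
    [ChartedSpace (EuclideanHalfSpace k) Y] [IsManifold (𝓡∂ k) ∞ Y]
    (ι : Y → M) (hι : ContMDiff (𝓡∂ k) (𝓡 m) ∞ ι) (hemb : Topology.IsEmbedding ι)
    (himm : ∀ y, Function.Injective (mfderiv (𝓡∂ k) (𝓡 m) ι y))
    (hbd : (𝓡∂ k).boundary Y = ι ⁻¹' D.locus)
    (hclean : ∀ y ∈ (𝓡∂ k).boundary Y,
      (boundaryTangent y).map (mfderiv (𝓡∂ k) (𝓡 m) ι y).toLinearMap =
        LinearMap.range (mfderiv (𝓡∂ k) (𝓡 m) ι y).toLinearMap ⊓ D.tangent (ι y)) :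
    ∃ Φ : (y : Y) → Fibre (logFields (I := 𝓡∂ k) (ι ⁻¹' D.locus)) y →ₗ[ℝ]
        Fibre D.ellipticFields (ι y),
      IsSmoothBundleMap D.ellipticFields ι (logFields (I := 𝓡∂ k) (ι ⁻¹' D.locus)) Φ ∧
      (∀ y v, anchor D.ellipticFields (ι y) (Φ y v) =
        mfderiv (𝓡∂ k) (𝓡 m) ι y (anchor _ y v)) ∧
      (∀ Ψ : (y : Y) → Fibre (logFields (I := 𝓡∂ k) (ι ⁻¹' D.locus)) y →ₗ[ℝ]
          Fibre D.ellipticFields (ι y),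
        IsSmoothBundleMap D.ellipticFields ι (logFields (I := 𝓡∂ k) (ι ⁻¹' D.locus)) Ψ →
        (∀ y ∉ (𝓡∂ k).boundary Y, ∀ v, anchor D.ellipticFields (ι y) (Ψ y v) =
          mfderiv (𝓡∂ k) (𝓡 m) ι y (anchor _ y v)) →
        Ψ = Φ) ∧
      ∀ q : ℕ, ∃ P : Form D.ellipticFields q →ₗ[ℝ]
          Form (logFields (I := 𝓡∂ k) (ι ⁻¹' D.locus)) q,
        (∀ α y v, (P α).1 y v = α.1 (ι y) fun i => Φ y (v i)) ∧
        (∀ α, ∀ y ∉ (𝓡∂ k).boundary Y, ∀ v w,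
          (∀ i, anchor D.ellipticFields (ι y) (w i) =
            mfderiv (𝓡∂ k) (𝓡 m) ι y (anchor _ y (v i))) →
          (P α).1 y v = α.1 (ι y) w) ∧
        ∀ α (β : Form (logFields (I := 𝓡∂ k) (ι ⁻¹' D.locus)) q),
          (∀ y ∉ (𝓡∂ k).boundary Y, β.1 y = (P α).1 y) → β = P α := by
  -- Cutoff functions on Y require it to be Hausdorff, which is inherited from M through the
  -- embedding.
  have : T2Space Y := hemb.t2Space
  exact D.exists_pushforward_pullback hι himm hbd hclean
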